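/- Let $\Sigma$ be a finite alphabet. An instance of the closest substring problem consists of $t\ge 1$ sequences $S_1,\dots,S_t\in\Sigma^n$ and a pattern length $l$ with $1\le l\le n$. A feasible solution is a tuple $(y_1,\dots,y_t)$, where $y_i$ is a length-$l$ substring of $S_i$. Its cost is $\sum_{i=1}^t d(v,y_i)$, where $d$ is the Hamming distance and $v$ is the consensus (column-wise majority string) of $y_1,\dots,y_t$. An optimal solution is one of minimum cost. An $r$-sample is a choice of $r$ length-$l$ substrings (given by their positions), no two of them from the same sequence. Write $$\rho(s,r)=1+\frac{4s-4}{\sqrt e\,(\sqrt{4r+1}-3)} .$$ The Li–Ma–Wang algorithm $P_r$ takes every $r$-sample, computes its consensus $v$, chooses from every sequence $S_i$ a substring closest to $v$, and returns the cheapest of the solutions so obtained. The reoptimization algorithm $A_r$ receives $S_1,\dots,S_t$, $l$, and an optimal solution OPT for the sub-instance $S_1,\dots,S_r$, $r\le t$. It computes (A) the extension of OPT by a substring of each $S_{r+1},\dots,S_t$ closest to the consensus of OPT (K-BEST-ALIGN), and (B) the cheapest solution obtained as in $P_r$ from those $r$-samples that are not contained in $S_1,\dots,S_r$. It returns the cheaper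 of (A) and (B). **Theorem.** Running times are numbers of elementary steps of a random access machine (memory accesses, including those to a zero-initialised table of counters indexed by $\Sigma$; arithmetic operations and comparisons on integers; equality tests of symbols). 1. For all $r\ge 3$ and $t\ge r$, the solution returned by $A_r$ has cost at most $\rho(|\Sigma|,r)$ times the cost of an optimal solution for $S_1,\dots,S_t$. 2. For every fixed $r\ge 1$ there is a constant $C_r$, independent of $\Sigma,t,n,l$, such that for all $t>r$ the algorithm $A_r$ runs in at most $C_r\cdot l\,t\,n\,((t-r)n)^r$ steps. 3. For comparison, if $t\ge r$, then $P_r$ has the same approximation guarantee $\rho(|\Sigma|,r)$ when $r\ge3$, and for every fixed $r\ge1$ it runs in $O_r\big(l\,(tn)^{r+1}\big)$ steps. 4. For every fixed $|\Sigma|$, $\rho(|\Sigma|,r)\to 1$ as $r\to\infty$ (so the algorithms form a polynomial-time approximation scheme). -/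

import Mathlib

/-! ### Computations with a step count -/

/-- A computation on a random access machine: its result together with the number of elementary
steps it takes.  Elementary steps are: reading or writing a memory cell (a symbol of a sequence, an
entry of an array), one arithmetic operation or comparison on integers, and one equality test
between symbols. -/
@[ext]
structure Timed (β : Type) where
  val : β
  steps : ℕ

namespace Timed

/-- Sequential composition adds the numbers of steps; returning a value that is already present
is free. -/
instance : Monad Timed where
  pure x := ⟨x, 0⟩
  bind m f := ⟨(f m.val).val, m.steps + (f m.val).steps⟩

/-- One elementary step with result `x`. -/
def op {β : Type} (x : β) : Timed β := ⟨x, 1⟩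

/-- `for x in xs do s := f s x`: one step per iteration for advancing the loop, one step for
leaving it, and the steps of the loop bodies. -/
def loop {β γ : Type} : List β → γ → (γ → β → Timed γ) → Timed γ
  | [], s, _ => op s
  | x :: xs, s, f => do
      op ()
      let s' ← f s x
      loop xs s' f

/-- Fill an array of length `m`, entry by entry: the steps for computing every entry, and two
steps per entry for advancing the loop and writing the entry. -/
def fill {β : Type} {m : ℕ} (f : Fin m → Timed β) : Timed (Fin m → β) :=
  ⟨fun j => (f j).val, 1 + ∑ j, ((f j).steps + 2)⟩

theorem loop_val {β γ : Type} (xs : List β) (s : γ) (f : γ → β → Timed γ) :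
    (loop xs s f).val = xs.foldl (fun s x => (f s x).val) s := by
  induction xs generalizing s with
  | nil => rfl
  | cons x xs ih => exact ih _

end Timed

open Timed

/-! ### The closest substring problem -/

/-- An instance of the closest substring problem: `t ≥ 1` sequences of length `n` over the
alphabet `α`, and a pattern length `1 ≤ l ≤ n`. -/
structure CSPInstance (α : Type) (t n l : ℕ) where
  t_pos : 0 < t
  l_pos : 0 < l
  l_le_n : l ≤ n
  seq : Fin t → Fin n → α

/-- Starting positions of the substrings of length `l` in a sequence of length `n`. -/
abbrev Pos (n l : ℕ) : Type := Fin (n - l + 1)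

/-- An occurrence of a substring: the index of a sequence and a starting position in it. -/
abbrev Occ (t n l : ℕ) : Type := Fin t × Pos n l

/-- A feasible solution `(y₁, …, y_t)`: one substring of length `l` from each sequence, given by
its starting position. -/
abbrev Sol (t n l : ℕ) : Type := Fin t → Pos n l

namespace CSPInstance

variable {α : Type} {t n l : ℕ}

/-- The index of the `j`-th letter of the substring that starts at `p`. -/
def letterIndex (I : CSPInstance α t n l) (p : Pos n l) (j : Fin l) : Fin n :=
  ⟨p + j, by have := I.l_le_n; have := p.2; have := j.2; omega⟩

/-- The substring of length `l` at an occurrence. -/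
def sub (I : CSPInstance α t n l) (q : Occ t n l) : Fin l → α :=
  fun j => I.seq q.1 (I.letterIndex q.2 j)

/-- The number of the sequences whose selected substring has symbol `a` in column `j`. -/
def columnCount [DecidableEq α] (I : CSPInstance α t n l) (y : Sol t n l) (j : Fin l) (a : α) :
    ℕ :=
  (Finset.univ.filter fun i => I.sub (i, y i) j = a).card

/-- `v` is a consensus of the solution `y`: in every column it has a symbol of maximal count. -/
def IsConsensus [DecidableEq α] (I : CSPInstance α t n l) (y : Sol t n l) (v : Fin l → α) : Prop :=
  ∀ j a, I.columnCount y j a ≤ I.columnCount y j (v j)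

theorem exists_isConsensus [Fintype α] [DecidableEq α] (I : CSPInstance α t n l) (y : Sol t n l) :
    ∃ v, I.IsConsensus y v := by
  have h : ∀ j, ∃ b, ∀ a, I.columnCount y j a ≤ I.columnCount y j b := fun j =>
    haveI : Nonempty α := ⟨I.sub (⟨0, I.t_pos⟩, 0) j⟩
    Finite.exists_max (I.columnCount y j)
  choose v hv using h
  exact ⟨v, hv⟩

/-- A consensus of `y` (ties are broken arbitrarily; the cost below does not depend on how). -/
noncomputable def consensusOf [Fintype α] [DecidableEq α] (I : CSPInstance α t n l)
    (y : Sol t n l) : Fin l → α :=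
  (I.exists_isConsensus y).choose

/-- The cost of a solution: the total Hamming distance of its substrings to their consensus. -/
noncomputable def cost [Fintype α] [DecidableEq α] (I : CSPInstance α t n l) (y : Sol t n l) : ℕ :=
  ∑ i, hammingDist (I.consensusOf y) (I.sub (i, y i))

/-- Optimal solutions. -/
def IsOptimal [Fintype α] [DecidableEq α] (I : CSPInstance α t n l) (y : Sol t n l) : Prop :=
  ∀ z : Sol t n l, I.cost y ≤ I.cost z

/-- The sub-instance formed by the first `r` sequences. -/
def firstSeqs (I : CSPInstance α t n l) (r : ℕ) (hr : 0 < r) (hrt : r ≤ t) :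
    CSPInstance α r n l where
  t_pos := hr
  l_pos := I.l_pos
  l_le_n := I.l_le_n
  seq := fun i => I.seq (Fin.castLE hrt i)

/-! ### The algorithms -/

/-- Read the `j`-th letter of an occurrence: one addition and one memory access. -/
def read (I : CSPInstance α t n l) (q : Occ t n l) (j : Fin l) : Timed α := do
  let k ← op (I.letterIndex q.2 j)
  op (I.seq q.1 k)

/-- State of the search for a majority symbol: a table of counters indexed by the symbols, the
largest counter so far, and a symbol that attains it. -/
structure Tally (α : Type) where
  count : α → ℕ
  top : ℕ
  sym : α

/-- Count the symbols in column `j` of the occurrences `occ x`, `x ∈ xs`, starting from an all-zero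
table (and an arbitrary symbol, here one from the first sequence). -/
def tally [DecidableEq α] {β : Type} (I : CSPInstance α t n l) (xs : List β)
    (occ : β → Occ t n l) (j : Fin l) : Timed (Tally α) :=
  loop xs ⟨fun _ => 0, 0, I.sub (⟨0, I.t_pos⟩, 0) j⟩ fun T x => do
    let q ← op (occ x)
    let a ← I.read q j
    let c ← op (T.count a)
    let c' ← op (c + 1)
    let table ← op (Function.update T.count a c')
    let larger ← op (decide (T.top < c'))
    if larger then do
      let top ← op c'
      let sym ← op a
      pure ⟨table, top, sym⟩
    else pure ⟨table, T.top, T.sym⟩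

/-- Reset to zero the counters that `tally` has used. -/
def clear [DecidableEq α] {β : Type} (I : CSPInstance α t n l) (xs : List β)
    (occ : β → Occ t n l) (j : Fin l) (table : α → ℕ) : Timed (α → ℕ) :=
  loop xs table fun table x => do
    let q ← op (occ x)
    let a ← I.read q j
    op (Function.update table a 0)

theorem tally_count_eq_zero [DecidableEq α] {β : Type} (I : CSPInstance α t n l)
    (occ : β → Occ t n l) (j : Fin l) (xs : List β) (a : α)
    (ha : ∀ x ∈ xs, I.sub (occ x) j ≠ a) : (I.tally xs occ j).val.count a = 0 := by
  rw [tally, Timed.loop_val]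
  suffices h : ∀ T : Tally α, T.count a = 0 → (xs.foldl _ T).count a = 0 from h _ rfl
  induction xs with
  | nil => exact fun T hT => hT
  | cons x xs ih =>
    intro T hT
    refine ih (fun y hy => ha y (List.mem_cons_of_mem _ hy)) _ ?_
    have hx : a ≠ I.sub (occ x) j := (ha x List.mem_cons_self).symm
    change Tally.count (Timed.val (ite _ _ _)) a = 0
    split_ifs
    all_goals exact (Function.update_of_ne hx _ _).trans hT

/-- After `clear` the table is all-zero again, as `tally` needs it. -/
theorem clear_tally [DecidableEq α] {β : Type} (I : CSPInstance α t n l) (xs : List β)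
    (occ : β → Occ t n l) (j : Fin l) :
    (I.clear xs occ j (I.tally xs occ j).val.count).val = fun _ => 0 := by
  have key : ∀ (ys : List β) (T : α → ℕ) (a : α),
      (T a = 0 ∨ ∃ x ∈ ys, I.sub (occ x) j = a) → (I.clear ys occ j T).val a = 0 := by
    intro ys
    induction ys with
    | nil => rintro T a (h | ⟨x, hx, _⟩)
             · exact h
             · simp at hx
    | cons y ys ih =>
      intro T a h
      refine ih (Function.update T (I.sub (occ y) j) 0) a ?_
      by_cases hy : a = I.sub (occ y) j
      · left; simp [hy]
      · rw [Function.update_of_ne hy]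
        rcases h with h | ⟨x, hx, hxa⟩
        · exact Or.inl h
        · rcases List.mem_cons.1 hx with rfl | hx
          · exact absurd hxa.symm hy
          · exact Or.inr ⟨x, hx, hxa⟩
  funext a
  apply key
  by_cases h : ∃ x ∈ xs, I.sub (occ x) j = a
  · exact Or.inr h
  · exact Or.inl (I.tally_count_eq_zero occ j xs a fun x hx hxa => h ⟨x, hx, hxa⟩)

/-- The consensus pattern of the occurrences `occ x`, `x ∈ xs`: the majority symbol of each
column.  One table of counters serves all the columns, since it is cleared after each of them. -/
def consensus [DecidableEq α] {β : Type} (I : CSPInstance α t n l) (xs : List β)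
    (occ : β → Occ t n l) : Timed (Fin l → α) :=
  fill fun j => do
    let T ← I.tally xs occ j
    let _ ← I.clear xs occ j T.count
    op T.sym

/-- The Hamming distance between a string and an occurrence. -/
def dist [DecidableEq α] (I : CSPInstance α t n l) (v : Fin l → α) (q : Occ t n l) : Timed ℕ :=
  loop (List.finRange l) 0 fun d j => do
    let a ← op (v j)
    let b ← I.read q j
    let same ← op (decide (a = b))
    if same then pure d else op (d + 1)

/-- The position of a substring of the `i`-th sequence that is closest to `v`. -/
def bestAlign [DecidableEq α] (I : CSPInstance α t n l) (v : Fin l → α) (i : Fin t) :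
    Timed (Pos n l) := do
  let best ← loop (List.finRange (n - l + 1)) ((⊤ : ℕ∞), (0 : Pos n l)) fun best p => do
    let d ← I.dist v (i, p)
    let closer ← op (decide ((d : ℕ∞) < best.1))
    if closer then do
      let min ← op (d : ℕ∞)
      let y ← op p
      pure (min, y)
    else pure best
  pure best.2

/-- Align a closest substring of every sequence to `v`. -/
def alignAll [DecidableEq α] (I : CSPInstance α t n l) (v : Fin l → α) : Timed (Sol t n l) :=
  fill fun i => I.bestAlign v i

/-- K-BEST-ALIGN: extend a solution for the first `r` sequences by closest substrings, in the other
sequences, to its consensus. -/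
def kBestAlign [DecidableEq α] (I : CSPInstance α t n l) {r : ℕ} (hrt : r ≤ t)
    (sol : Sol r n l) : Timed (Sol t n l) := do
  let v ← I.consensus (List.finRange r) fun i => (Fin.castLE hrt i, sol i)
  fill fun i => do
    let known ← op (decide ((i : ℕ) < r))
    if known then
      if h : (i : ℕ) < r then op (sol ⟨i, h⟩) else I.bestAlign v i
    else I.bestAlign v i

/-- Compute the cost of a solution. -/
def computeCost [DecidableEq α] (I : CSPInstance α t n l) (y : Sol t n l) : Timed ℕ := do
  let v ← I.consensus (List.finRange t) fun i => (i, y i)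
  loop (List.finRange t) 0 fun c i => do
    let p ← op (y i)
    let d ← I.dist v (i, p)
    op (c + d)

/-- Run `body` on every sample that extends `w` by `d` occurrences taken from `d` different
sequences with index less than `bound`.  Started with `d = r`, `bound = t` and `w = []` it visits
each `r`-sample (at most one substring from each sequence) exactly once. -/
def forSamples {t n l : ℕ} {γ : Type} (body : γ → List (Occ t n l) → Timed γ) :
    (d bound : ℕ) → (w : List (Occ t n l)) → γ → Timed γ
  | 0, _, w, s => body s w
  | d + 1, bound, w, s =>
      loop ((List.finRange t).take bound) s fun s i =>
        loop (List.finRange (n - l + 1)) s fun s p => do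
          let w' ← op ((i, p) :: w)
          forSamples body d i w' s

/-- Is every member of the sample `w` a substring of one of the first `r` sequences? -/
def inFirst {t n l : ℕ} (r : ℕ) (w : List (Occ t n l)) : Timed Bool :=
  loop w true fun b q => do
    let c ← op (decide ((q.1 : ℕ) < r))
    op (b && c)

/-- The cheapest solution (with its cost) obtained from the `r`-samples that are not skipped, by
aligning all the sequences to the consensus of the sample; `(⊤, none)` if there is no such
sample. -/
def bestSampled [DecidableEq α] (I : CSPInstance α t n l) (r : ℕ)
    (skip : List (Occ t n l) → Timed Bool) : Timed (ℕ∞ × Option (Sol t n l)) :=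
  forSamples (fun best w => do
      let b ← skip w
      if b then pure best
      else do
        let v ← I.consensus w id
        let y ← I.alignAll v
        let c ← I.computeCost y
        let cheaper ← op (decide ((c : ℕ∞) < best.1))
        if cheaper then do
          let min ← op (c : ℕ∞)
          let sol ← op (some y)
          pure (min, sol)
        else pure best)
    r t [] (⊤, none)

/-- The approximation algorithm of Li, Ma and Wang with sampling size `r`: all `r`-samples are
tried. (There is no sample, and no output, if `t < r`.) -/
def ptas [DecidableEq α] (I : CSPInstance α t n l) (r : ℕ) : Timed (Option (Sol t n l)) := do
  let best ← I.bestSampled r fun _ => pure false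
  pure best.2

/-- The reoptimization algorithm: given a solution `sol` for the first `r` sequences, return the
cheaper one of K-BEST-ALIGN of `sol` and the best solution that is obtained from the `r`-samples
that are not samples of the first `r` sequences. -/
def reoptPTAS [DecidableEq α] (I : CSPInstance α t n l) {r : ℕ} (hrt : r ≤ t)
    (sol : Sol r n l) : Timed (Sol t n l) := do
  let solA ← I.kBestAlign hrt sol
  let best ← I.bestSampled r (inFirst r)
  let costA ← I.computeCost solA
  let smaller ← op (decide ((costA : ℕ∞) < best.1))
  if smaller then pure solA else pure (best.2.getD solA)

end CSPInstance

/-- The approximation ratio for alphabet size `s` and sampling size `r`. -/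
noncomputable def approxRatio (s r : ℕ) : ℝ :=
  1 + (4 * (s : ℝ) - 4) / (√(Real.exp 1) * (√(4 * (r : ℝ) + 1) - 3))

/-! Fix a solution `y` of the whole instance and let `S` run over the `r`-subsets of the sequences;
each `S` gives the sample of the substrings of `y` in `S`, with consensus `V S`. Aligning everything
to `V S` costs at most the total distance from `V S` to `y`, so it is enough to find one admissible
`S` for which this distance is at most the ratio times the cost of `y`. This is done by averaging
over `S`, column by column. In a column with majority letter `b`, a sample with winner `a` loses
`c_b - c_a = u t`. By a Chernoff argument `a` wins in at most a fraction `(1 - u²)^(r/2)` of the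
samples; since sequences are drawn without replacement, Maclaurin's inequality takes the place of
independence (`sum_powersetCard_prod_le`, `card_filter_majority_le`). The optimum pays `t - c_b ≥ t
(1 - u) / 2` in that column, and calculus (`mul_sqrt_one_sub_sq_pow_le`) bounds the quotient, with a
factor `1 + 1/r` to spare. That factor pays for discarding one subset, the first `r` sequences: if
`r < t` there are at least `r + 1` subsets (`exists_sample_le`). So the samples alone give the
guarantee when `r < t`; when `r = t` all are skipped and OPT itself is returned. For the running
time, `t ≤ (r + 1) (t - r)` when `r < t`, so even enumerating the skipped samples costs only a
factor `(r + 1)^r`. -/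

/-! ### Running times. -/

namespace Timed

variable {β γ : Type}

@[simp] theorem bind_val (m : Timed β) (f : β → Timed γ) : (m >>= f).val = (f m.val).val := rfl

@[simp] theorem bind_steps (m : Timed β) (f : β → Timed γ) :
    (m >>= f).steps = m.steps + (f m.val).steps := rfl

@[simp] theorem pure_val (x : β) : (pure x : Timed β).val = x := rfl

@[simp] theorem pure_steps (x : β) : (pure x : Timed β).steps = 0 := rfl

@[simp] theorem op_val (x : β) : (op x).val = x := rfl

@[simp] theorem op_steps (x : β) : (op x).steps = 1 := rfl

@[simp] theorem fill_val {m : ℕ} (f : Fin m → Timed β) (j : Fin m) :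
    (fill f).val j = (f j).val := rfl

theorem loop_steps_le (xs : List β) (s : γ) (f : γ → β → Timed γ) (B : ℕ)
    (h : ∀ s, ∀ x ∈ xs, (f s x).steps ≤ B) : (loop xs s f).steps ≤ xs.length * (B + 1) + 1 := by
  induction xs generalizing s with
  | nil => simp [loop]
  | cons x xs ih =>
    have h1 := h s x List.mem_cons_self
    have h2 := ih (f s x).val fun s y hy => h s y (List.mem_cons_of_mem _ hy)
    simp only [loop, bind_steps, op_steps, List.length_cons, add_mul]
    omega

theorem fill_steps_le {m : ℕ} (f : Fin m → Timed β) (B : ℕ) (h : ∀ j, (f j).steps ≤ B) :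
    (fill f).steps ≤ 1 + m * (B + 2) := by
  have := Finset.sum_le_card_nsmul Finset.univ (fun j => (f j).steps + 2) (B + 2)
    fun j _ => Nat.add_le_add_right (h j) 2
  simpa [fill] using this

end Timed

namespace CSPInstance

variable {α : Type} {t n l : ℕ}

theorem read_steps (I : CSPInstance α t n l) (q : Occ t n l) (j : Fin l) :
    (I.read q j).steps = 2 := rfl

variable [DecidableEq α]

theorem tally_steps_le {β : Type} (I : CSPInstance α t n l) (xs : List β) (occ : β → Occ t n l)
    (j : Fin l) : (I.tally xs occ j).steps ≤ xs.length * 10 + 1 := by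
  refine loop_steps_le _ _ _ 9 fun T x _ => ?_
  simp only [bind_steps, op_steps, read_steps]
  split_ifs <;> simp only [bind_steps, op_steps, pure_steps] <;> omega

theorem clear_steps_le {β : Type} (I : CSPInstance α t n l) (xs : List β) (occ : β → Occ t n l)
    (j : Fin l) (table : α → ℕ) : (I.clear xs occ j table).steps ≤ xs.length * 5 + 1 :=
  loop_steps_le _ _ _ 4 fun _ _ _ => le_rfl

theorem consensus_steps_le {β : Type} (I : CSPInstance α t n l) (xs : List β)
    (occ : β → Occ t n l) : (I.consensus xs occ).steps ≤ 1 + l * (xs.length * 15 + 5) := by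
  refine (fill_steps_le _ (xs.length * 15 + 3) fun j => ?_)
  have h1 := I.tally_steps_le xs occ j
  have h2 := I.clear_steps_le xs occ j (I.tally xs occ j).val.count
  simp only [bind_steps, op_steps]
  omega

theorem dist_steps_le (I : CSPInstance α t n l) (v : Fin l → α) (q : Occ t n l) :
    (I.dist v q).steps ≤ l * 6 + 1 := by
  have := loop_steps_le (List.finRange l) 0 (fun d j => do
    let a ← op (v j)
    let b ← I.read q j
    let same ← op (decide (a = b))
    if same then pure d else op (d + 1)) 5 fun d j _ => by
      simp only [bind_steps, op_steps, read_steps]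
      split_ifs <;> simp only [op_steps, pure_steps] <;> omega
  simpa [dist] using this

theorem bestAlign_steps_le (I : CSPInstance α t n l) (v : Fin l → α) (i : Fin t) :
    (I.bestAlign v i).steps ≤ 12 * (n * l) := by
  have := loop_steps_le (List.finRange (n - l + 1)) ((⊤ : ℕ∞), (0 : Pos n l))
    (fun best p => do
      let d ← I.dist v (i, p)
      let closer ← op (decide ((d : ℕ∞) < best.1))
      if closer then do
        let min ← op (d : ℕ∞)
        let y ← op p
        pure (min, y)
      else pure best) (l * 6 + 4) fun best p _ => by
      have h := I.dist_steps_le v (i, p)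
      simp only [bind_steps, op_steps]
      split_ifs <;> simp only [bind_steps, op_steps, pure_steps] <;> omega
  have hl := I.l_pos
  have hn := I.l_le_n
  have h2 : (I.bestAlign v i).steps ≤ (n - l + 1) * (l * 6 + 4 + 1) + 1 := by
    simpa [bestAlign] using this
  have h3 : (n - l + 1) * (l * 6 + 4 + 1) ≤ n * (11 * l) := Nat.mul_le_mul (by omega) (by omega)
  have h4 : 1 ≤ n * l := Nat.mul_pos (by omega) hl
  nlinarith

theorem alignAll_steps_le (I : CSPInstance α t n l) (v : Fin l → α) :
    (I.alignAll v).steps ≤ 15 * (l * t * n) := by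
  have h := fill_steps_le (fun i => I.bestAlign v i) _ (I.bestAlign_steps_le v)
  have hn : 1 ≤ n * l := Nat.mul_pos (I.l_pos.trans_le I.l_le_n) I.l_pos
  have ht := I.t_pos
  have h2 : 1 + t * (12 * (n * l) + 2) ≤ 15 * (l * t * n) := by nlinarith
  exact h.trans h2

theorem kBestAlign_steps_le (I : CSPInstance α t n l) {r : ℕ} (hrt : r ≤ t) (sol : Sol r n l) :
    (I.kBestAlign hrt sol).steps ≤ 40 * (l * t * n) := by
  have hn : 1 ≤ n * l := Nat.mul_pos (I.l_pos.trans_le I.l_le_n) I.l_pos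
  have hn1 : 1 ≤ n := I.l_pos.trans_le I.l_le_n
  have hl := I.l_pos
  have ht := I.t_pos
  have h1 := I.consensus_steps_le (List.finRange r) fun i => (Fin.castLE hrt i, sol i)
  rw [List.length_finRange] at h1
  simp only [kBestAlign, bind_steps]
  generalize (I.consensus (List.finRange r) fun i => (Fin.castLE hrt i, sol i)) = V at h1 ⊢
  have h2 := fill_steps_le (fun i : Fin t => do
    let known ← op (decide ((i : ℕ) < r))
    if known then
      if h : (i : ℕ) < r then op (sol ⟨i, h⟩) else I.bestAlign V.val i
    else I.bestAlign V.val i) (12 * (n * l) + 1) fun i => by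
      have hb := I.bestAlign_steps_le V.val i
      simp only [bind_steps, op_steps, op_val]
      by_cases h : (i : ℕ) < r
      · simp only [h, decide_true, if_true, dite_true, op_steps]
        omega
      · simp only [h, decide_false, Bool.false_eq_true, if_false]
        omega
  have h3 : l * (r * 15 + 5) ≤ l * (t * 20) := Nat.mul_le_mul_left _ (by omega)
  have h4 : l * t ≤ l * t * n := Nat.le_mul_of_pos_right _ hn1
  have h5 : t ≤ l * t := Nat.le_mul_of_pos_left _ hl
  refine (Nat.add_le_add h1 h2).trans ?_
  nlinarith

theorem computeCost_steps_le (I : CSPInstance α t n l) (y : Sol t n l) :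
    (I.computeCost y).steps ≤ 40 * (l * t * n) := by
  have hn1 : 1 ≤ n := I.l_pos.trans_le I.l_le_n
  have hl := I.l_pos
  have ht := I.t_pos
  have h1 := I.consensus_steps_le (List.finRange t) fun i => (i, y i)
  rw [List.length_finRange] at h1
  simp only [computeCost, bind_steps]
  generalize (I.consensus (List.finRange t) fun i => (i, y i)) = V at h1 ⊢
  have h2 := loop_steps_le (List.finRange t) 0 (fun c i => do
    let p ← op (y i)
    let d ← I.dist V.val (i, p)
    op (c + d)) (l * 6 + 3) fun c i _ => by
      have := I.dist_steps_le V.val (i, y i)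
      simp only [bind_steps, op_steps, op_val]
      omega
  rw [List.length_finRange] at h2
  have h3 : l * (t * 15 + 5) ≤ l * (t * 20) := Nat.mul_le_mul_left _ (by omega)
  have h4 : l * t ≤ l * t * n := Nat.le_mul_of_pos_right _ hn1
  have h5 : t ≤ l * t := Nat.le_mul_of_pos_left _ hl
  refine (Nat.add_le_add h1 h2).trans ?_
  nlinarith

/-- Each level of the recursion multiplies the work by at most `t * N` calls; the factor 6 per level
absorbs the overhead of the two nested loops, because a call is budgeted at least one step. -/
theorem forSamples_steps_le {γ : Type} (body : γ → List (Occ t n l) → Timed γ) (k N B : ℕ)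
    (ht : 0 < t) (hn : n - l + 1 ≤ N) (hB : 1 ≤ B)
    (hbody : ∀ s w, w.length = k → (body s w).steps ≤ B) :
    ∀ (d bound : ℕ) (w : List (Occ t n l)) (s : γ), w.length + d = k →
      (forSamples body d bound w s).steps ≤ 6 ^ d * (t * N) ^ d * B
  | 0, _, w, s, hw => by simpa [forSamples] using hbody s w (by simpa using hw)
  | d + 1, bound, w, s, hw => by
    have hN : 1 ≤ N := by omega
    set T := 6 ^ d * (t * N) ^ d * B with hT
    have hT1 : 1 ≤ T := Nat.mul_pos (by positivity) hB
    have inner : ∀ (s : γ) (i : Fin t), (loop (List.finRange (n - l + 1)) s fun s p => do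
        let w' ← op ((i, p) :: w)
        forSamples body d i w' s).steps ≤ (n - l + 1) * (T + 1 + 1) + 1 := by
      intro s i
      have := loop_steps_le (List.finRange (n - l + 1)) s (fun s p => do
        let w' ← op ((i, p) :: w)
        forSamples body d i w' s) (T + 1) fun s p _ => by
          have := forSamples_steps_le body k N B ht hn hB hbody d i ((i, p) :: w) s
            (by simp; omega)
          simp only [bind_steps, op_steps, op_val]
          omega
      rwa [List.length_finRange] at this
    have outer := loop_steps_le ((List.finRange t).take bound) s (fun s i =>
      loop (List.finRange (n - l + 1)) s fun s p => do
          let w' ← op ((i, p) :: w)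
          forSamples body d i w' s) _ fun s i _ => inner s i
    have hlen : ((List.finRange t).take bound).length ≤ t := by simp
    have e : 6 ^ (d + 1) * (t * N) ^ (d + 1) * B = 6 * (t * (N * T)) := by rw [hT]; ring
    rw [e]
    refine (show (forSamples body (d + 1) bound w s).steps ≤ _ from outer).trans ?_
    have h1 : (n - l + 1) * (T + 1 + 1) ≤ N * (3 * T) := Nat.mul_le_mul hn (by omega)
    have h2 : 1 ≤ N * T := Nat.mul_pos hN hT1
    have h3 : 1 ≤ t * (N * T) := Nat.mul_pos ht h2
    calc _ ≤ t * (N * (3 * T) + 1 + 1) + 1 :=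
          Nat.add_le_add_right (Nat.mul_le_mul hlen (by omega)) 1
      _ ≤ t * (5 * (N * T)) + t * (N * T) :=
          Nat.add_le_add (Nat.mul_le_mul_left _ (by nlinarith)) h3
      _ = _ := by ring

theorem inFirst_steps_le (r : ℕ) (w : List (Occ t n l)) :
    (inFirst r w).steps ≤ w.length * 3 + 1 :=
  loop_steps_le _ _ _ 2 fun _ _ _ => le_rfl

/-- Per sample: the consensus takes about `l (15 r + 5)` steps, the skip test `3 r`, and aligning,
costing and bookkeeping `15 + 40 + 5` units of `l t n`. The allowance for `skip` fits both `inFirst`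
and the free test of `ptas`. -/
theorem bestSampled_steps_le (I : CSPInstance α t n l) (r : ℕ)
    (skip : List (Occ t n l) → Timed Bool) (hskip : ∀ w, (skip w).steps ≤ w.length * 3 + 1) :
    (I.bestSampled r skip).steps ≤ 6 ^ r * (t * n) ^ r * ((18 * r + 65) * (l * t * n)) := by
  have hn1 : 1 ≤ n := I.l_pos.trans_le I.l_le_n
  have hl := I.l_pos
  have ht := I.t_pos
  have hln := I.l_le_n
  have h4 : l * t ≤ l * t * n := Nat.le_mul_of_pos_right _ hn1
  have h5 : l ≤ l * t := Nat.le_mul_of_pos_right _ ht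
  have h6 : 1 ≤ l * t * n := by omega
  refine forSamples_steps_le _ r n _ ht (by omega) (Nat.mul_pos (by omega) h6) ?_ r t [] _ (by simp)
  intro s w hw
  have h1 := hskip w
  have h2 := I.consensus_steps_le w id
  rw [hw] at h1 h2
  have h7 : l * (r * 15 + 5) ≤ l * t * n * (r * 15 + 5) := Nat.mul_le_mul_right _ (by omega)
  have h8 : r ≤ l * t * n * r := Nat.le_mul_of_pos_left _ h6
  have e : (18 * r + 65) * (l * t * n)
    = l * t * n * (r * 15 + 5) + 3 * (l * t * n * r) + 60 * (l * t * n) := by ring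
  rw [e]
  have h9 := I.alignAll_steps_le (I.consensus w id).val
  have h10 := I.computeCost_steps_le (I.alignAll (I.consensus w id).val).val
  simp only [bind_steps]
  split_ifs <;> simp only [bind_steps, op_steps, pure_steps]
  · omega
  · split_ifs <;> simp only [bind_steps, op_steps, pure_steps] <;> omega

theorem ptas_steps_le (I : CSPInstance α t n l) (r : ℕ) :
    (I.ptas r).steps ≤ 6 ^ r * (18 * r + 65) * (l * (t * n) ^ (r + 1)) := by
  have := I.bestSampled_steps_le r (fun _ => pure false) fun _ => Nat.zero_le _
  refine (show (I.ptas r).steps ≤ _ from this).trans (le_of_eq ?_)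
  ring

theorem reoptPTAS_steps_le (I : CSPInstance α t n l) {r : ℕ} (hrt : r < t) (sol : Sol r n l) :
    (I.reoptPTAS hrt.le sol).steps ≤
      (6 ^ r * (18 * r + 65) * (r + 1) ^ r + 81) * (l * t * n * ((t - r) * n) ^ r) := by
  have hn1 : 1 ≤ n := I.l_pos.trans_le I.l_le_n
  have h1 := I.kBestAlign_steps_le hrt.le sol
  have h2 := I.bestSampled_steps_le r (inFirst r) (inFirst_steps_le r)
  have h3 := I.computeCost_steps_le (I.kBestAlign hrt.le sol).val
  have h4 : 1 ≤ l * t * n := Nat.mul_pos (Nat.mul_pos I.l_pos I.t_pos) hn1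
  have h5 : l * t * n ≤ l * t * n * ((t - r) * n) ^ r :=
    Nat.le_mul_of_pos_right _ (pow_pos (Nat.mul_pos (by omega) hn1) _)
  -- With `t - r ≥ 1`, the product is `(t - r) + r (t - r) ≥ (t - r) + r`. This converts the count
  -- of all samples into a power of `(t - r) n`.
  have h6 : t ≤ (r + 1) * (t - r) := by
    obtain ⟨k, rfl⟩ := Nat.exists_eq_add_of_lt hrt
    rw [show r + k + 1 - r = k + 1 by omega]
    nlinarith
  have h7 : (t * n) ^ r ≤ (r + 1) ^ r * ((t - r) * n) ^ r := by
    rw [← mul_pow]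
    exact Nat.pow_le_pow_left (by nlinarith) _
  have h8 : 6 ^ r * (t * n) ^ r * ((18 * r + 65) * (l * t * n)) ≤
      6 ^ r * (18 * r + 65) * (r + 1) ^ r * (l * t * n * ((t - r) * n) ^ r) :=
    calc _ ≤ 6 ^ r * ((r + 1) ^ r * ((t - r) * n) ^ r) * ((18 * r + 65) * (l * t * n)) := by
          gcongr
      _ = _ := by ring
  rw [reoptPTAS]
  simp only [bind_steps, op_steps, add_mul]
  split_ifs <;> simp only [pure_steps] <;> omega

end CSPInstance

/-! ### Loop invariants and the values computed by the algorithms. -/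

namespace Timed

variable {β γ : Type}

/-- An invariant of a loop, given the reversed list of the elements already treated. -/
theorem loop_invariant (P : List β → γ → Prop) (f : γ → β → Timed γ)
    (hf : ∀ done x s, P done s → P (x :: done) (f s x).val) (xs : List β) {s : γ} (hs : P [] s) :
    P xs.reverse (loop xs s f).val := by
  suffices h : ∀ (xs done : List β) (s : γ), P done s → P (xs.reverse ++ done) (loop xs s f).val by
    simpa using h xs [] s hs
  intro xs
  induction xs with
  | nil => exact fun done s h => h
  | cons x xs ih =>
    intro done s h
    have := ih (x :: done) _ (hf done x s h)
    simpa [loop] using this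

theorem loop_preserves (P : γ → Prop) (f : γ → β → Timed γ) (hf : ∀ x s, P s → P (f s x).val)
    (xs : List β) {s : γ} (hs : P s) : P (loop xs s f).val :=
  loop_invariant (fun _ => P) f (fun _ x s h => hf x s h) xs hs

/-- A bound that is reached at one element of a loop, and that the other iterations keep. -/
theorem loop_reaches (P : γ → Prop) (f : γ → β → Timed γ) (hf : ∀ x s, P s → P (f s x).val)
    {xs : List β} {x : β} (hx : x ∈ xs) (hfx : ∀ s, P (f s x).val) (s : γ) :
    P (loop xs s f).val := by
  induction xs generalizing s with
  | nil => simp at hx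
  | cons y xs ih =>
    rcases List.mem_cons.1 hx with rfl | hx
    · exact loop_preserves P f hf xs (hfx s)
    · exact ih hx _

end Timed

namespace CSPInstance

variable {α : Type} [DecidableEq α] {t n l : ℕ}

theorem tally_val {β : Type} (I : CSPInstance α t n l) (xs : List β) (occ : β → Occ t n l)
    (j : Fin l) (a : α) :
    xs.countP (fun x => I.sub (occ x) j = a) ≤
      xs.countP (fun x => I.sub (occ x) j = (I.tally xs occ j).val.sym) := by
  have h := loop_invariant (fun done (T : Tally α) =>
      (∀ a, T.count a = done.countP fun x => I.sub (occ x) j = a) ∧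
      (∀ a, T.count a ≤ T.top) ∧ T.count T.sym = T.top)
    (fun T x => do
      let q ← op (occ x)
      let a ← I.read q j
      let c ← op (T.count a)
      let c' ← op (c + 1)
      let table ← op (Function.update T.count a c')
      let larger ← op (decide (T.top < c'))
      if larger then do
        let top ← op c'
        let sym ← op a
        pure ⟨table, top, sym⟩
      else pure ⟨table, T.top, T.sym⟩)
    (fun done x T ⟨h1, h2, h3⟩ => by
      set b := I.sub (occ x) j with hb
      have hcount : ∀ a, Function.update T.count b (T.count b + 1) a =
          (x :: done).countP fun x => I.sub (occ x) j = a := fun a => by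
        rw [List.countP_cons, ← h1, ← hb]
        rcases eq_or_ne a b with rfl | hab
        · simp
        · simp [hab, hab.symm]
      change (fun T' : Tally α => (∀ a, T'.count a = (x :: done).countP fun x =>
        I.sub (occ x) j = a) ∧ (∀ a, T'.count a ≤ T'.top) ∧ T'.count T'.sym = T'.top)
        (Timed.val (ite (decide (T.top < T.count b + 1) = true) _ _))
      split_ifs with hlt
      · have hlt := of_decide_eq_true hlt
        refine ⟨hcount, fun a => ?_, by change Function.update T.count b _ b = _; simp⟩
        change Function.update T.count b (T.count b + 1) a ≤ T.count b + 1
        rcases eq_or_ne a b with rfl | hab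
        · simp
        · rw [Function.update_of_ne hab]
          exact (h2 a).trans hlt.le
      · have hlt : ¬(T.top < T.count b + 1) := by simpa using hlt
        -- The current leader has count `top`, so reading it once more would have exceeded `top`.
        have hsym : T.sym ≠ b := fun e => by rw [← e, h3] at hlt; omega
        refine ⟨hcount, fun a => ?_, (Function.update_of_ne hsym _ _).trans h3⟩
        change Function.update T.count b (T.count b + 1) a ≤ T.top
        rcases eq_or_ne a b with rfl | hab
        · simpa using hlt
        · rw [Function.update_of_ne hab]
          exact h2 a)
    xs (s := ⟨fun _ => 0, 0, I.sub (⟨0, I.t_pos⟩, 0) j⟩) ⟨by simp, by simp, rfl⟩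
  obtain ⟨h1, h2, h3⟩ := h
  have := h2 a
  rw [← h3, h1, h1, List.countP_reverse, List.countP_reverse] at this
  exact this

theorem consensus_val {β : Type} (I : CSPInstance α t n l) (xs : List β) (occ : β → Occ t n l)
    (j : Fin l) (a : α) :
    xs.countP (fun x => I.sub (occ x) j = a) ≤
      xs.countP (fun x => I.sub (occ x) j = (I.consensus xs occ).val j) :=
  I.tally_val xs occ j a

theorem dist_val (I : CSPInstance α t n l) (v : Fin l → α) (q : Occ t n l) :
    (I.dist v q).val = hammingDist v (I.sub q) := by
  have h := loop_invariant (fun done d => d = (done.map fun j => if v j ≠ I.sub q j then 1 else 0).sum)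
    (fun d j => do
      let a ← op (v j)
      let b ← I.read q j
      let same ← op (decide (a = b))
      if same then pure d else op (d + 1))
    (fun done j d hd => by
      change Timed.val (ite (decide (v j = I.sub q j) = true) _ _) = _
      split_ifs with hj
      · have := of_decide_eq_true hj
        simp [this, hd]
      · have : v j ≠ I.sub q j := by simpa using hj
        simp [this, hd, add_comm])
    (List.finRange l) (s := 0) rfl
  refine Eq.trans (show (I.dist v q).val = _ from h) ?_
  rw [List.map_reverse, List.sum_reverse, hammingDist, Finset.card_filter, Fin.sum_univ_def]

theorem bestAlign_val (I : CSPInstance α t n l) (v : Fin l → α) (i : Fin t) (p : Pos n l) :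
    hammingDist v (I.sub (i, (I.bestAlign v i).val)) ≤ hammingDist v (I.sub (i, p)) := by
  have h := loop_invariant (fun done (best : ℕ∞ × Pos n l) =>
      (∀ p ∈ done, best.1 ≤ (I.dist v (i, p)).val) ∧
      (best.1 = ⊤ ∨ best.1 = (I.dist v (i, best.2)).val))
    (fun best p => do
      let d ← I.dist v (i, p)
      let closer ← op (decide ((d : ℕ∞) < best.1))
      if closer then do
        let min ← op (d : ℕ∞)
        let y ← op p
        pure (min, y)
      else pure best)
    (fun done p best ⟨h1, h2⟩ => by
      change (fun b : ℕ∞ × Pos n l => (∀ p' ∈ p :: done, b.1 ≤ (I.dist v (i, p')).val) ∧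
        (b.1 = ⊤ ∨ b.1 = (I.dist v (i, b.2)).val))
        (Timed.val (ite (decide (((I.dist v (i, p)).val : ℕ∞) < best.1) = true) _ _))
      split_ifs with hlt
      · have hlt := of_decide_eq_true hlt
        refine ⟨fun p' hp' => ?_, Or.inr rfl⟩
        rcases List.mem_cons.1 hp' with rfl | hp'
        · exact le_rfl
        · exact hlt.le.trans (h1 p' hp')
      · have hlt : ¬((I.dist v (i, p)).val : ℕ∞) < best.1 := by simpa using hlt
        refine ⟨fun p' hp' => ?_, h2⟩
        rcases List.mem_cons.1 hp' with rfl | hp'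
        · exact not_lt.1 hlt
        · exact h1 p' hp')
    (List.finRange (n - l + 1)) (s := ((⊤ : ℕ∞), (0 : Pos n l))) ⟨by simp, Or.inl rfl⟩
  change (∀ p ∈ _, _) ∧ (_ ∨ _ = ((I.dist v (i, (I.bestAlign v i).val)).val : ℕ∞)) at h
  have hp := h.1 p (by simp)
  -- The initial value `⊤` cannot survive: the loop has visited `p`, whose distance is finite.
  rcases h.2 with h2 | h2 <;> rw [h2] at hp
  · simp at hp
  · simpa [dist_val] using hp

/-! ### Cost as a sum over columns. -/

section Cost

theorem columnCount_eq_countP (I : CSPInstance α t n l) (y : Sol t n l) (j : Fin l) (a : α) :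
    I.columnCount y j a = (List.finRange t).countP fun i => I.sub (i, y i) j = a := by
  rw [columnCount, Finset.card_def, Finset.filter_val, ← Multiset.countP_eq_card_filter]
  rfl

/-- Exchange of summation over sequences and columns. It makes both the optimality of the consensus
and the later averaging a matter of single columns. -/
theorem sum_hammingDist_eq (I : CSPInstance α t n l) (y : Sol t n l) (v : Fin l → α) :
    ∑ i, hammingDist v (I.sub (i, y i)) = ∑ j, (t - I.columnCount y j (v j)) := by
  simp only [hammingDist, Finset.card_filter]
  rw [Finset.sum_comm]
  refine Finset.sum_congr rfl fun j _ => ?_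
  have h := Finset.card_filter_add_card_filter_not (s := Finset.univ)
    fun i => I.sub (i, y i) j = v j
  rw [Finset.card_univ, Fintype.card_fin] at h
  rw [← Finset.card_filter, columnCount,
    Finset.filter_congr (q := fun i => ¬ (I.sub (i, y i) j = v j)) fun i _ => by rw [ne_comm]]
  omega

theorem IsConsensus.sum_hammingDist_le {I : CSPInstance α t n l} {y : Sol t n l} {v : Fin l → α}
    (hv : I.IsConsensus y v) (w : Fin l → α) :
    ∑ i, hammingDist v (I.sub (i, y i)) ≤ ∑ i, hammingDist w (I.sub (i, y i)) := by
  rw [sum_hammingDist_eq, sum_hammingDist_eq]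
  exact Finset.sum_le_sum fun j _ => Nat.sub_le_sub_left (hv j (w j)) t

variable [Fintype α]

theorem isConsensus_consensusOf (I : CSPInstance α t n l) (y : Sol t n l) :
    I.IsConsensus y (I.consensusOf y) :=
  (I.exists_isConsensus y).choose_spec

theorem cost_le_sum_hammingDist (I : CSPInstance α t n l) (y : Sol t n l) (v : Fin l → α) :
    I.cost y ≤ ∑ i, hammingDist v (I.sub (i, y i)) :=
  (I.isConsensus_consensusOf y).sum_hammingDist_le v

theorem cost_eq_of_isConsensus {I : CSPInstance α t n l} {y : Sol t n l} {v : Fin l → α}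
    (hv : I.IsConsensus y v) : I.cost y = ∑ i, hammingDist v (I.sub (i, y i)) :=
  le_antisymm (I.cost_le_sum_hammingDist y v) (hv.sum_hammingDist_le _)

theorem computeCost_val (I : CSPInstance α t n l) (y : Sol t n l) :
    (I.computeCost y).val = I.cost y := by
  set v := (I.consensus (List.finRange t) fun i => (i, y i)).val with hv
  have hc : I.IsConsensus y v := fun j a => by
    rw [columnCount_eq_countP, columnCount_eq_countP]
    exact I.consensus_val _ _ j a
  have h := loop_invariant
    (fun done c => c = (done.map fun i => hammingDist v (I.sub (i, y i))).sum)
    (fun c i => do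
      let p ← op (y i)
      let d ← I.dist v (i, p)
      op (c + d))
    (fun done i c hc => by
      change c + (I.dist v (i, y i)).val = _
      rw [dist_val, hc, List.map_cons, List.sum_cons, add_comm])
    (List.finRange t) (s := 0) rfl
  refine Eq.trans (show (I.computeCost y).val = _ from h) ?_
  rw [List.map_reverse, List.sum_reverse, cost_eq_of_isConsensus hc, Fin.sum_univ_def]

/-- Aligning all the sequences to `v` costs at most the distance from `v` of any solution. -/
theorem cost_alignAll_le (I : CSPInstance α t n l) (v : Fin l → α) (y : Sol t n l) :
    I.cost (I.alignAll v).val ≤ ∑ i, hammingDist v (I.sub (i, y i)) :=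
  (I.cost_le_sum_hammingDist _ v).trans
    (Finset.sum_le_sum fun i _ => I.bestAlign_val v i (y i))

end Cost

theorem forSamples_preserves {γ : Type} (P : γ → Prop) (body : γ → List (Occ t n l) → Timed γ)
    (hbody : ∀ s w, P s → P (body s w).val) :
    ∀ (d bound : ℕ) (w : List (Occ t n l)) (s : γ), P s → P (forSamples body d bound w s).val
  | 0, _, w, s, hs => hbody s w hs
  | d + 1, bound, w, s, hs => by
    rw [forSamples]
    refine loop_preserves P _ (fun i s hs => ?_) _ hs
    refine loop_preserves P _ (fun p s hs => ?_) _ hs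
    exact forSamples_preserves P body hbody d i ((i, p) :: w) s hs

/-- Every choice of positions in the sequences of a set of indices is visited. -/
theorem exists_forSamples_reaches (y : Sol t n l) :
    ∀ (d bound : ℕ) (w : List (Occ t n l)) (S : Finset (Fin t)), S.card = d →
      (∀ i ∈ S, (i : ℕ) < bound) →
      ∃ w' : List (Occ t n l), (w' : Multiset (Occ t n l)) = S.val.map (fun i => (i, y i)) + w ∧
        ∀ {γ : Type} (P : γ → Prop) (body : γ → List (Occ t n l) → Timed γ),
          (∀ s w, P s → P (body s w).val) → (∀ s, P (body s w').val) →
          ∀ s, P (forSamples body d bound w s).val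
  | 0, _, w, S, hS, _ =>
    ⟨w, by simp [Finset.card_eq_zero.1 hS], fun P body _ h s => h s⟩
  | d + 1, bound, w, S, hS, hb => by
    have hne : S.Nonempty := Finset.card_pos.1 (by omega)
    -- `forSamples` picks indices in decreasing order, so the largest index of `S` comes first and
    -- serves as the strict bound for the rest.
    set i := S.max' hne with hi
    have hiS : i ∈ S := S.max'_mem hne
    obtain ⟨w', hw', h⟩ := exists_forSamples_reaches y d i ((i, y i) :: w) (S.erase i)
      (by rw [Finset.card_erase_of_mem hiS, hS]; rfl)
      (fun k hk => S.lt_max'_of_mem_erase_max' hne hk)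
    refine ⟨w', ?_, fun P body hP hw s => ?_⟩
    · rw [hw', ← Multiset.cons_coe, Multiset.add_cons, ← Multiset.cons_add,
        ← Multiset.map_cons (fun i => (i, y i)), ← Finset.insert_val_of_notMem (by simp),
        Finset.insert_erase hiS]
    · have hmem : i ∈ (List.finRange t).take bound := by
        rw [List.mem_take_iff_getElem]
        exact ⟨i, by simp [hb i hiS], by simp⟩
      rw [forSamples]
      refine loop_reaches P _ (fun k s hs => ?_) hmem (fun s => ?_) s
      · refine loop_preserves P _ (fun p s hs => ?_) _ hs
        exact forSamples_preserves P body hP d k ((k, p) :: w) s hs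
      · refine loop_reaches P _ (fun p s hs => ?_) (List.mem_finRange (y i)) (fun s => ?_) s
        · exact forSamples_preserves P body hP d i ((i, p) :: w) s hs
        · exact h P body hP hw s

theorem inFirst_val (r : ℕ) (w : List (Occ t n l)) :
    (inFirst r w).val = true ↔ ∀ q ∈ w, (q.1 : ℕ) < r := by
  have h := loop_invariant (fun done b => (b = true ↔ ∀ q ∈ done, ((q : Occ t n l).1 : ℕ) < r))
    (fun b q => do
      let c ← op (decide ((q.1 : ℕ) < r))
      op (b && c))
    (fun done q b hb => by
      change (b && decide ((q.1 : ℕ) < r)) = true ↔ _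
      simp [hb, and_comm]) w (s := true) (by simp)
  simpa using (show (inFirst r w).val = true ↔ _ from h)

/-- Covers the degenerate case `t = r`, where every sample lies in the first `r` sequences. -/
theorem bestSampled_of_forall_skip (I : CSPInstance α t n l) (r : ℕ)
    (skip : List (Occ t n l) → Timed Bool) (h : ∀ w, (skip w).val = true) :
    (I.bestSampled r skip).val = (⊤, none) := by
  refine forSamples_preserves (fun s => s = (⊤, none)) _ (fun s w hs => ?_) _ _ _ _ rfl
  simp only [bind_val, h, if_true]
  exact hs

theorem kBestAlign_val (I : CSPInstance α t n l) {r : ℕ} (hrt : r ≤ t) (sol : Sol r n l)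
    {i : Fin t} (h : (i : ℕ) < r) : (I.kBestAlign hrt sol).val i = sol ⟨i, h⟩ := by
  simp only [kBestAlign, bind_val, fill_val]
  rw [if_pos (show (op (decide ((i : ℕ) < r))).val = true from decide_eq_true h), dif_pos h]
  rfl

section BestSampled

variable [Fintype α]

/-- Strips the step counting from the loop body, leaving the update of a running minimum. -/
theorem bestSampled_body_val (I : CSPInstance α t n l) (b : Bool) (best : ℕ∞ × Option (Sol t n l))
    (w : List (Occ t n l)) :
    (if b then pure best
      else do
        let v ← I.consensus w id
        let y ← I.alignAll v
        let c ← I.computeCost y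
        let cheaper ← op (decide ((c : ℕ∞) < best.1))
        if cheaper then do
          let min ← op (c : ℕ∞)
          let sol ← op (some y)
          pure (min, sol)
        else pure best : Timed (ℕ∞ × Option (Sol t n l))).val =
    if b then best else
      if (I.cost (I.alignAll (I.consensus w id).val).val : ℕ∞) < best.1 then
        ((I.cost (I.alignAll (I.consensus w id).val).val : ℕ∞),
          some (I.alignAll (I.consensus w id).val).val)
      else best := by
  split_ifs with h1 h2
  · rfl
  · rw [← computeCost_val] at h2 ⊢
    change Timed.val (ite (decide _ = true) _ _) = _
    rw [if_pos (decide_eq_true h2)]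
    rfl
  · rw [← computeCost_val] at h2
    change Timed.val (ite (decide _ = true) _ _) = _
    rw [if_neg (by simpa using h2)]
    rfl

theorem bestSampled_preserves (I : CSPInstance α t n l) (r : ℕ)
    (skip : List (Occ t n l) → Timed Bool) (P : ℕ∞ × Option (Sol t n l) → Prop)
    (hP : ∀ s y, (I.cost y : ℕ∞) < s.1 → P s → P (I.cost y, some y))
    (h0 : P (⊤, none)) : P (I.bestSampled r skip).val := by
  refine forSamples_preserves P _ (fun s w hs => ?_) _ _ _ _ h0
  rw [bind_val]
  rw [I.bestSampled_body_val]
  split_ifs with h1 h2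
  · exact hs
  · exact hP _ _ h2 hs
  · exact hs

theorem bestSampled_val (I : CSPInstance α t n l) (r : ℕ)
    (skip : List (Occ t n l) → Timed Bool) :
    (I.bestSampled r skip).val = (⊤, none) ∨
      ∃ y, (I.bestSampled r skip).val = ((I.cost y : ℕ∞), some y) :=
  I.bestSampled_preserves r skip (fun s => s = (⊤, none) ∨ ∃ y, s = ((I.cost y : ℕ∞), some y))
    (fun _ y _ _ => Or.inr ⟨y, rfl⟩) (Or.inl rfl)

/-- A string that is a consensus of the substrings of `y` in the sequences of `S` such that the
result of `bestSampled` is at most the cost of aligning to it. -/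
theorem exists_bestSampled_le (I : CSPInstance α t n l) {r : ℕ}
    (skip : List (Occ t n l) → Timed Bool) (y : Sol t n l) (S : Finset (Fin t))
    (hS : S.card = r)
    (hskip : ∀ w : List (Occ t n l), (∀ i ∈ S, (i, y i) ∈ w) → (skip w).val = false) :
    ∃ v : Fin l → α, (∀ j a, (S.filter fun i => I.sub (i, y i) j = a).card ≤
        (S.filter fun i => I.sub (i, y i) j = v j).card) ∧
      (I.bestSampled r skip).val.1 ≤ (I.cost (I.alignAll v).val : ℕ) := by
  obtain ⟨w, hw, h⟩ := exists_forSamples_reaches y r t [] S hS fun i _ => i.2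
  rw [Multiset.coe_nil, add_zero] at hw
  -- The visited list is known only up to order, which suffices because a consensus depends only on
  -- letter counts.
  have hcount : ∀ j a, w.countP (fun q => I.sub q j = a) =
      (S.filter fun i => I.sub (i, y i) j = a).card := fun j a => by
    rw [← Multiset.coe_countP, hw, Multiset.countP_map, Finset.card_def, Finset.filter_val]
  refine ⟨(I.consensus w id).val, fun j a => ?_, ?_⟩
  · rw [← hcount, ← hcount]
    exact I.consensus_val w id j a
  · have hw' : (skip w).val = false := hskip w fun i hi => by
      rw [← Multiset.mem_coe, hw]
      exact Multiset.mem_map_of_mem _ hi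
    refine h (fun s : ℕ∞ × Option (Sol t n l) =>
      s.1 ≤ (I.cost (I.alignAll (I.consensus w id).val).val : ℕ)) _ (fun s w' hs => ?_)
      (fun s => ?_) _
    · rw [bind_val, I.bestSampled_body_val]
      split_ifs with h1 h2
      · exact hs
      · exact h2.le.trans hs
      · exact hs
    · rw [bind_val, I.bestSampled_body_val, hw', if_neg Bool.false_ne_true]
      split_ifs with h2
      · exact le_rfl
      · exact not_lt.1 h2

end BestSampled

end CSPInstance

/-! ### Maclaurin's inequality for elementary symmetric sums. -/

section Maclaurin

open Finset

/-- Double counting through the bijection `(S, i ∈ S) ↔ (S \ {i}, i)`. -/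
theorem sum_powersetCard_succ_erase {ι M : Type*} [Fintype ι] [DecidableEq ι] [AddCommMonoid M]
    (k : ℕ) (f : Finset ι → ι → M) :
    ∑ S ∈ powersetCard (k + 1) univ, ∑ i ∈ S, f (S.erase i) i =
      ∑ R ∈ powersetCard k univ, ∑ i ∈ Rᶜ, f R i := by
  rw [sum_sigma', sum_sigma']
  refine sum_bij' (fun x _ => ⟨x.1.erase x.2, x.2⟩) (fun x _ => ⟨insert x.2 x.1, x.2⟩) ?_ ?_ ?_ ?_ ?_
  · rintro ⟨S, i⟩ h
    simp only [mem_sigma, mem_powersetCard_univ, mem_compl] at h ⊢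
    exact ⟨by rw [card_erase_of_mem h.2, h.1]; rfl, notMem_erase _ _⟩
  · rintro ⟨R, i⟩ h
    simp only [mem_sigma, mem_powersetCard_univ, mem_compl] at h ⊢
    exact ⟨by rw [card_insert_of_notMem h.2, h.1], mem_insert_self _ _⟩
  · rintro ⟨S, i⟩ h
    simp only [mem_sigma] at h
    simp [insert_erase h.2]
  · rintro ⟨R, i⟩ h
    simp only [mem_sigma, mem_compl] at h
    simp [erase_insert h.2]
  · rintro ⟨S, i⟩ _
    rfl

theorem sum_compl_sum_compl_powersetCard_prod {ι : Type*} [Fintype ι] [DecidableEq ι]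
    (z : ι → ℝ) (k : ℕ) :
    ∑ R ∈ powersetCard k univ, ∑ i ∈ Rᶜ, (∏ x ∈ R, z x) * z i =
      (k + 1) * ∑ S ∈ powersetCard (k + 1) univ, ∏ i ∈ S, z i := by
  rw [← sum_powersetCard_succ_erase k fun R i => (∏ x ∈ R, z x) * z i, mul_sum]
  refine sum_congr rfl fun S hS => ?_
  rw [sum_congr rfl fun i hi => prod_erase_mul S z hi, sum_const, (mem_powersetCard.1 hS).2]
  simp

/-- One step of Maclaurin's inequality for elementary symmetric sums. -/
theorem card_mul_sum_powersetCard_succ_prod_le {ι : Type*} [Fintype ι] [DecidableEq ι]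
    {z : ι → ℝ} (hz : ∀ i, 0 ≤ z i) {k : ℕ} (hk : k < Fintype.card ι) :
    Fintype.card ι * ((k + 1) * ∑ S ∈ powersetCard (k + 1) univ, ∏ i ∈ S, z i) ≤
      (Fintype.card ι - k) * ((∑ S ∈ powersetCard k univ, ∏ i ∈ S, z i) * ∑ i, z i) := by
  obtain _ | k := k
  · simp [powersetCard_one]
  set t := Fintype.card ι
  set E := ∑ S ∈ powersetCard (k + 1 + 1) univ, ∏ i ∈ S, z i
  set A := ∑ Q ∈ powersetCard k univ, (∏ x ∈ Q, z x) * ∑ i ∈ Qᶜ, z i ^ 2 with hA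
  -- Expand the product: an index outside `S` gives a squarefree monomial, each arising `k + 2`
  -- times; an index inside `S` gives a monomial with one square, collected in `A`.
  have split : (∑ S ∈ powersetCard (k + 1) univ, ∏ i ∈ S, z i) * ∑ i, z i =
      ((k + 1 : ℕ) + 1) * E + A := by
    have h2 : ∑ S ∈ powersetCard (k + 1) univ, ∑ i ∈ S, (∏ x ∈ S, z x) * z i = A := by
      have := sum_powersetCard_succ_erase k fun R i => (∏ x ∈ R, z x) * z i * z i
      rw [sum_congr rfl fun S _ => sum_congr rfl fun i hi => by rw [prod_erase_mul S z hi]] at this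
      rw [this]
      refine sum_congr rfl fun Q _ => ?_
      rw [mul_sum]
      exact sum_congr rfl fun i _ => by ring
    rw [← sum_compl_sum_compl_powersetCard_prod, ← h2, ← sum_add_distrib, sum_mul]
    refine sum_congr rfl fun S _ => ?_
    rw [← sum_compl_add_sum S, mul_add, mul_sum, mul_sum]
  -- Cauchy–Schwarz on the `t - k` indices outside each `k`-set `Q`, weighted by the product over
  -- `Q` and summed. Combined with `split`, this is the claim.
  have key : ((k + 1 : ℕ) : ℝ) * (((k + 1 : ℕ) + 1) * E) + A ≤ (t - k) * A := by
    have h1 : ∑ Q ∈ powersetCard k univ, (∏ x ∈ Q, z x) * (∑ i ∈ Qᶜ, z i) ^ 2 =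
        ((k + 1 : ℕ) : ℝ) * (((k + 1 : ℕ) + 1) * E) + A := by
      rw [← sum_compl_sum_compl_powersetCard_prod]
      have h3 : ∑ R ∈ powersetCard (k + 1) univ, ∑ i ∈ Rᶜ, (∏ x ∈ R, z x) * z i =
          ∑ R ∈ powersetCard (k + 1) univ, (∏ x ∈ R, z x) * ∑ i ∈ Rᶜ, z i :=
        sum_congr rfl fun R _ => (mul_sum _ _ _).symm
      have h4 := sum_powersetCard_succ_erase k fun Q i =>
        (∏ x ∈ Q, z x) * z i * ∑ j ∈ (insert i Q)ᶜ, z j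
      rw [sum_congr rfl fun S hS => sum_congr rfl (g := fun _ => (∏ x ∈ S, z x) * ∑ j ∈ Sᶜ, z j)
        fun i hi => by rw [prod_erase_mul S z hi, insert_erase hi]] at h4
      rw [sum_congr rfl fun S hS => by rw [sum_const, (mem_powersetCard.1 hS).2, nsmul_eq_mul],
        ← mul_sum] at h4
      rw [h3, h4, hA, ← sum_add_distrib]
      refine sum_congr rfl fun Q _ => ?_
      have h5 : (∏ x ∈ Q, z x) * (∑ i ∈ Qᶜ, z i) ^ 2 =
          ∑ i ∈ Qᶜ, (∏ x ∈ Q, z x) * z i * ∑ j ∈ Qᶜ, z j := by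
        rw [← sum_mul, ← mul_sum]
        ring
      rw [h5, mul_sum Qᶜ fun i => z i ^ 2, ← sum_add_distrib]
      refine sum_congr rfl fun i hi => ?_
      rw [compl_insert, ← add_sum_erase _ _ hi]
      ring
    rw [← h1, hA, mul_sum]
    refine sum_le_sum fun Q hQ => ?_
    have hc : ((Qᶜ).card : ℝ) = t - k := by
      rw [card_compl, (mem_powersetCard.1 hQ).2, Nat.cast_sub (by omega)]
    have := sq_sum_le_card_mul_sum_sq (s := Qᶜ) (f := z)
    rw [hc] at this
    calc _ ≤ (∏ x ∈ Q, z x) * ((t - k) * ∑ i ∈ Qᶜ, z i ^ 2) :=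
          mul_le_mul_of_nonneg_left this (prod_nonneg fun i _ => hz i)
      _ = _ := by ring
  rw [split]
  push_cast at key ⊢
  nlinarith

/-- Maclaurin's inequality between an elementary symmetric mean and the arithmetic mean. -/
theorem sum_powersetCard_prod_le {ι : Type*} [Fintype ι] [DecidableEq ι] [Nonempty ι]
    {z : ι → ℝ} (hz : ∀ i, 0 ≤ z i) {k : ℕ} (hk : k ≤ Fintype.card ι) :
    ∑ S ∈ powersetCard k univ, ∏ i ∈ S, z i ≤
      (Fintype.card ι).choose k * ((∑ i, z i) / Fintype.card ι) ^ k := by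
  induction k with
  | zero => simp
  | succ k ih =>
    have ht : (0 : ℝ) < Fintype.card ι := by exact_mod_cast Fintype.card_pos
    have h1 := card_mul_sum_powersetCard_succ_prod_le hz (Nat.lt_of_succ_le hk)
    have h2 := ih (by omega)
    have hch : ((Fintype.card ι).choose (k + 1) : ℝ) * (k + 1) =
        (Fintype.card ι).choose k * (Fintype.card ι - k) := by
      have := Nat.choose_succ_right_eq (Fintype.card ι) k
      rw [← Nat.cast_sub (by omega)]
      exact_mod_cast this
    have hZ : 0 ≤ ∑ i, z i := sum_nonneg fun i _ => hz i
    have hkt : (0 : ℝ) ≤ Fintype.card ι - k := by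
      have : (k : ℝ) + 1 ≤ Fintype.card ι := by exact_mod_cast hk
      linarith
    have h3 := h1.trans (mul_le_mul_of_nonneg_left (mul_le_mul_of_nonneg_right h2 hZ) hkt)
    set M := (∑ i, z i) / Fintype.card ι with hM
    have hM' : ∑ i, z i = M * Fintype.card ι := (div_mul_cancel₀ _ ht.ne').symm
    rw [hM'] at h3
    have hpos : (0 : ℝ) < Fintype.card ι * (k + 1) := by positivity
    refine le_of_mul_le_mul_left ?_ hpos
    calc _ = (Fintype.card ι : ℝ) *
          ((k + 1) * ∑ S ∈ powersetCard (k + 1) univ, ∏ i ∈ S, z i) := by ring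
      _ ≤ _ := h3
      _ = (Fintype.card ι).choose k * (Fintype.card ι - k) * M ^ k * M * Fintype.card ι := by ring
      _ = _ := by rw [← hch]; ring

end Maclaurin

/-! ### The one-variable inequality behind the ratio. -/

section Analysis

open Real

theorem sqrt_one_sub_sq_le_exp {u : ℝ} : √(1 - u ^ 2) ≤ exp (-(u ^ 2 / 2)) := by
  rw [sqrt_le_left (exp_pos _).le, ← exp_nat_mul]
  have := add_one_le_exp (-u ^ 2)
  convert (show 1 - u ^ 2 ≤ exp (-u ^ 2) by linarith) using 2
  push_cast
  ring

/-- The bound behind the approximation ratio, with `r = z (z + 1)`. -/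
theorem mul_exp_bound {z u : ℝ} (hz : 1.79 ≤ z) (hu : 0 ≤ u) :
    (1 + 1 / (z * (z + 1))) * (u * (1 + u) * exp (-((z * (z + 1) - 2) * u ^ 2 / 2))) ≤
      1 / (exp (1 / 2) * (z - 1)) := by
  have hz0 : 0 < z := by linarith
  -- This bound and the next are `x + 1 ≤ exp x`, both tangent at `u = 1 / z`, close to the maximum;
  -- the whole product is then the exponential of a quadratic in `u`.
  have h1 : u ≤ exp (z * u - 1) / z := by
    rw [le_div_iff₀ hz0]
    linarith [add_one_le_exp (z * u - 1)]
  have h2 : 1 + u ≤ (z + 1) / z * exp ((z * u - 1) / (z + 1)) := by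
    calc 1 + u = (z + 1) / z * ((z * u - 1) / (z + 1) + 1) := by field_simp; ring
      _ ≤ _ := by gcongr; exact add_one_le_exp _
  set X := (z * u - 1) + (z * u - 1) / (z + 1) - (z * (z + 1) - 2) * u ^ 2 / 2 + 1 / 2 with hX
  have hXle : X ≤ 1 / z ^ 3 := by
    have hd : 0 < 2 * (z + 1) ^ 2 * (z - 1) := by
      have : 0 < z - 1 := by linarith
      positivity
    -- Completing the square in `u`.
    have e : X = (3 + z - z ^ 2) / (2 * (z + 1) ^ 2 * (z - 1)) -
        (z + 2) * (z - 1) / 2 * (u - z / ((z + 1) * (z - 1))) ^ 2 := by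
      have : z - 1 ≠ 0 := by linarith
      rw [hX]
      field_simp
      ring
    have h3 : (3 + z - z ^ 2) / (2 * (z + 1) ^ 2 * (z - 1)) ≤ 1 / z ^ 3 := by
      rw [div_le_div_iff₀ hd (by positivity)]
      -- Expanded around 1.79, the cleared polynomial inequality has only positive coefficients.
      obtain ⟨y, rfl⟩ : ∃ y, z = 1.79 + y := ⟨z - 1.79, by ring⟩
      have hy : 0 ≤ y := by linarith
      have : 0 ≤ y ^ 2 := by positivity
      have : 0 ≤ y ^ 3 := by positivity
      have : 0 ≤ y ^ 4 := by positivity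
      have : 0 ≤ y ^ 5 := by positivity
      ring_nf
      nlinarith
    have h4 : 0 ≤ (z + 2) * (z - 1) / 2 * (u - z / ((z + 1) * (z - 1))) ^ 2 := by
      have : 0 < z - 1 := by linarith
      positivity
    linarith
  have hz3 : 0 < z ^ 3 - 1 := by nlinarith [sq_nonneg z]
  have hexp : exp X ≤ z ^ 3 / (z ^ 3 - 1) := by
    have h5 : 1 - 1 / z ^ 3 ≤ exp (-X) := by linarith [add_one_le_exp (-X)]
    have h6 : z ^ 3 / (z ^ 3 - 1) = (1 - 1 / z ^ 3)⁻¹ := by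
      have := hz3.ne'
      field_simp
    rw [h6, ← inv_inv (exp X), ← exp_neg]
    refine inv_anti₀ ?_ h5
    rw [sub_pos, div_lt_one (by positivity)]
    linarith
  have hz1 : 0 < z - 1 := by linarith
  calc _ ≤ (1 + 1 / (z * (z + 1))) * ((exp (z * u - 1) / z) *
        ((z + 1) / z * exp ((z * u - 1) / (z + 1))) *
        exp (-((z * (z + 1) - 2) * u ^ 2 / 2))) := by
        gcongr
    _ = (1 + 1 / (z * (z + 1))) * ((z + 1) / z ^ 2) * (exp X / exp (1 / 2)) := by
        rw [← exp_sub, hX]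
        rw [show z * u - 1 + (z * u - 1) / (z + 1) - (z * (z + 1) - 2) * u ^ 2 / 2 + 1 / 2 - 1 / 2 =
          (z * u - 1) + (z * u - 1) / (z + 1) + -((z * (z + 1) - 2) * u ^ 2 / 2) by ring,
          exp_add, exp_add]
        field_simp
    _ ≤ (1 + 1 / (z * (z + 1))) * ((z + 1) / z ^ 2) * (z ^ 3 / (z ^ 3 - 1) / exp (1 / 2)) := by
        gcongr
    -- The bound `1 / z ^ 3` on `X` was chosen for this: the factor `z ^ 2 + z + 1` of `z ^ 3 - 1`
    -- cancels against `1 + 1 / (z * (z + 1))`, leaving exactly `1 / (z - 1)`.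
    _ = _ := by
        have : z ^ 3 - 1 = (z - 1) * (z ^ 2 + z + 1) := by ring
        rw [this]
        field_simp

/-- Here `u` is the relative gap between two letter counts. Two factors of the Chernoff bound have
been split off as `(1 - u) * (1 + u)`; the `1 - u` is charged to the optimum. -/
theorem mul_sqrt_one_sub_sq_pow_le {r : ℕ} (hr : 3 ≤ r) {u : ℝ} (hu : 0 ≤ u) (hu1 : u ≤ 1) :
    (1 + 1 / (r : ℝ)) * (u * (1 + u) * √(1 - u ^ 2) ^ (r - 2)) ≤
      2 / (√(exp 1) * (√(4 * r + 1) - 3)) := by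
  have hse : √(exp 1) = exp (1 / 2) := (exp_half 1).symm
  set q := √(4 * (r : ℝ) + 1) with hq
  have hq2 : q ^ 2 = 4 * r + 1 := sq_sqrt (by positivity)
  have hq0 : 0 ≤ q := sqrt_nonneg _
  rw [hse]
  have he : exp (1 / 2) ≤ 1.65 := by
    rw [← hse, sqrt_le_left (by norm_num)]
    linarith [exp_one_lt_d9]
  have hs0 : 0 ≤ 1 - u ^ 2 := by nlinarith
  have hs2 : √(1 - u ^ 2) ^ 2 = 1 - u ^ 2 := sq_sqrt hs0
  have hs := sqrt_nonneg (1 - u ^ 2)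
  -- Solving `z (z + 1) = r` gives `z ≥ 1.79` only from `r = 5` on; `r = 3` and `r = 4` are settled
  -- by crude numerical bounds.
  rcases Nat.lt_or_ge r 5 with h5 | h5
  · have hcase : r = 3 ∨ r = 4 := by omega
    rcases hcase with rfl | rfl
    · have hq3 : q ≤ 3.61 := by push_cast at hq2; nlinarith
      have hq4 : 3 < q := by push_cast at hq2; nlinarith
      have h1 : u * √(1 - u ^ 2) ≤ 1 / 2 := by nlinarith [sq_nonneg (u - √(1 - u ^ 2))]
      have h2 : exp (1 / 2) * (q - 3) ≤ 1.65 * 0.61 := by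
        gcongr; linarith
      have h3 : 4 / 3 ≤ 2 / (exp (1 / 2) * (q - 3)) := by
        rw [le_div_iff₀ (mul_pos (exp_pos _) (by linarith))]
        linarith
      refine le_trans ?_ h3
      norm_num
      nlinarith
    · have hq3 : q ≤ 4.124 := by push_cast at hq2; nlinarith
      have hq4 : 3 < q := by push_cast at hq2; nlinarith
      have h1 : u * (1 - u ^ 2) ≤ 0.4 := by nlinarith [sq_nonneg (u - 0.577)]
      have h2 : exp (1 / 2) * (q - 3) ≤ 1.65 * 1.124 := by
        gcongr; linarith
      have h3 : 1 ≤ 2 / (exp (1 / 2) * (q - 3)) := by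
        rw [le_div_iff₀ (mul_pos (exp_pos _) (by linarith))]
        linarith
      refine le_trans ?_ h3
      norm_num [hs2]
      nlinarith
  · have hr5 : (5 : ℝ) ≤ r := by exact_mod_cast h5
    set z := (q - 1) / 2 with hz
    have hzr : z * (z + 1) = r := by rw [hz]; nlinarith
    have hz1 : 1.79 ≤ z := by rw [hz]; nlinarith
    have h := mul_exp_bound hz1 hu
    rw [hzr] at h
    have e : 2 / (exp (1 / 2) * (q - 3)) = 1 / (exp (1 / 2) * (z - 1)) := by
      have : q - 3 = 2 * (z - 1) := by rw [hz]; ring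
      rw [this]
      have : z - 1 ≠ 0 := by linarith
      field_simp
    rw [e]
    refine le_trans ?_ h
    have h6 : √(1 - u ^ 2) ^ (r - 2) ≤ exp (-(((r : ℝ) - 2) * u ^ 2 / 2)) := by
      refine (pow_le_pow_left₀ hs sqrt_one_sub_sq_le_exp _).trans (le_of_eq ?_)
      rw [← exp_nat_mul, Nat.cast_sub (by omega)]
      congr 1
      push_cast
      ring
    gcongr

end Analysis

/-! ### How often a sample elects a wrong letter. -/

section Sampling

open Finset

variable {ι α : Type*} [Fintype ι] [DecidableEq α]

/-- The quantity is the share of a single wrong letter: the ratio minus one is `|Σ| - 1` times it.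
-/
theorem approxRatio_sub_one_nonneg {r : ℕ} (hr : 3 ≤ r) :
    0 ≤ 4 / (√(Real.exp 1) * (√(4 * (r : ℝ) + 1) - 3)) := by
  have h3 : (3 : ℝ) ≤ r := by exact_mod_cast hr
  have : 3 ≤ √(4 * (r : ℝ) + 1) := Real.le_sqrt_of_sq_le (by linarith)
  exact div_nonneg (by norm_num) (mul_nonneg (Real.sqrt_nonneg _) (by linarith))

theorem card_fiber_add_card_fiber_le (f : ι → α) {a b : α} (hab : a ≠ b) :
    #{i | f i = a} + #{i | f i = b} ≤ Fintype.card ι := by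
  classical
  rw [← card_union_of_disjoint]
  · exact card_le_univ _
  · rw [disjoint_filter]
    exact fun i _ h h' => hab (h.symm.trans h')

/-- How often, and at what expense, the letter `a` is the majority letter of a sample of the word
`f`, if `b` is a majority letter of `f`. -/
theorem card_filter_majority_le [DecidableEq ι] {r : ℕ} (hr : 3 ≤ r) (hrt : r ≤ Fintype.card ι)
    (f : ι → α) {a b : α} (hab : a ≠ b) (hle : #{i | f i = a} ≤ #{i | f i = b})
    {F : Finset (Finset ι)} (hF : F ⊆ powersetCard r univ)
    (V : Finset ι → α) (hV : ∀ S ∈ F, ∀ c, #{i ∈ S | f i = c} ≤ #{i ∈ S | f i = V S}) :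
    (1 + 1 / (r : ℝ)) * (#{S ∈ F | V S = a} * ((#{i | f i = b} : ℝ) - #{i | f i = a})) ≤
      (Fintype.card ι).choose r * (4 / (√(Real.exp 1) * (√(4 * (r : ℝ) + 1) - 3))) *
        (Fintype.card ι - #{i | f i = b}) := by
  have hsum : (#{i | f i = a} : ℝ) + #{i | f i = b} ≤ Fintype.card ι := by
    exact_mod_cast card_fiber_add_card_fiber_le f hab
  have hle' : (#{i | f i = a} : ℝ) ≤ #{i | f i = b} := by exact_mod_cast hle
  have ht0 : (0 : ℝ) < Fintype.card ι := by
    have : 0 < Fintype.card ι := by omega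
    exact_mod_cast this
  have : Nonempty ι := Fintype.card_pos_iff.1 (by omega)
  -- A letter that does not occur never wins a nonempty sample. Setting this case aside ensures `u <
  -- 1`, so that the weights below are defined.
  rcases Nat.eq_zero_or_pos #{i | f i = a} with h0 | hpos
  · have hempty : #{S ∈ F | V S = a} = 0 := by
      rw [card_eq_zero, filter_eq_empty_iff]
      intro S hS hVS
      obtain ⟨i, hi⟩ : S.Nonempty := card_pos.1 (by rw [(mem_powersetCard.1 (hF hS)).2]; omega)
      have h1 := hV S hS (f i)
      rw [hVS] at h1
      have h2 : #{k ∈ S | f k = a} ≤ #{k | f k = a} :=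
        card_le_card (filter_subset_filter _ (subset_univ S))
      have h3 : 0 < #{k ∈ S | f k = f i} := card_pos.2 ⟨i, by simp [hi]⟩
      omega
    rw [hempty]
    have h4 := approxRatio_sub_one_nonneg hr
    have h5 : (0 : ℝ) ≤ Fintype.card ι - #{i | f i = b} := by
      rw [h0] at hsum
      push_cast at hsum
      linarith
    simp only [Nat.cast_zero, zero_mul, mul_zero]
    positivity
  have hpos' : (0 : ℝ) < #{i | f i = a} := by exact_mod_cast hpos
  set t : ℝ := (Fintype.card ι : ℝ) with ht
  set ca : ℝ := (#{i | f i = a} : ℝ) with hca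
  set cb : ℝ := (#{i | f i = b} : ℝ) with hcb
  set u := (cb - ca) / t with hu
  have hut : u * t = cb - ca := div_mul_cancel₀ _ ht0.ne'
  have hu0 : 0 ≤ u := div_nonneg (by linarith) ht0.le
  have hu1 : u < 1 := by rw [hu, div_lt_one ht0]; linarith
  set s := √(1 - u ^ 2) with hs
  have hs2 : s ^ 2 = (1 - u) * (1 + u) := by rw [hs, Real.sq_sqrt] <;> nlinarith
  have hs0 : 0 < s := Real.sqrt_pos.2 (by nlinarith)
  have hs1 : s ≤ 1 := by nlinarith
  have hm : 0 < 1 - u := by linarith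
  have hp : 0 < 1 + u := by linarith
  -- The Chernoff weight `√((1 + u) / (1 - u))`: when `a` and `b` are the only letters it is `√(c_b
  -- / c_a)`, which minimises `c_a y + c_b / y`.
  set y := s / (1 - u) with hy
  have hy' : y⁻¹ = s / (1 + u) := by
    rw [hy, inv_div, div_eq_div_iff hs0.ne' hp.ne', ← hs2]
    ring
  have hy1 : 1 ≤ y := by
    rw [hy, le_div_iff₀ hm]
    nlinarith
  have hy0 : 0 < y := by linarith
  set z : ι → ℝ := fun i => (if f i = a then y else 1) * (if f i = b then y⁻¹ else 1) with hz
  have hz0 : ∀ i, 0 ≤ z i := fun i => by simp only [hz]; positivity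
  have hprod : ∀ S : Finset ι, ∏ i ∈ S, z i = y ^ #{i ∈ S | f i = a} * y⁻¹ ^ #{i ∈ S | f i = b} :=
    fun S => by
      rw [hz, prod_mul_distrib, prod_ite, prod_ite]
      simp
  have hzsum : ∑ i, z i = t + ca * (y - 1) + cb * (y⁻¹ - 1) := by
    have : ∀ i, z i = 1 + (if f i = a then y - 1 else 0) + (if f i = b then y⁻¹ - 1 else 0) :=
      fun i => by
        simp only [hz]
        by_cases h1 : f i = a
        · have h2 : f i ≠ b := fun h => hab (h1.symm.trans h)
          simp [h1, hab]
        · by_cases h2 : f i = b <;> simp [h1, h2, hab.symm]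
    rw [sum_congr rfl fun i _ => this i, sum_add_distrib, sum_add_distrib, ← sum_filter,
      ← sum_filter]
    simp only [sum_const, nsmul_eq_mul, card_univ, mul_one, ht, hca, hcb]
  -- Equality holds when only `a` and `b` occur; every other letter has weight 1 and leaves the
  -- slack `(1 - s) / s` computed in `e`.
  have hmean : (∑ i, z i) / t ≤ s := by
    rw [div_le_iff₀ ht0, hzsum, hy', hy]
    have e : s * t - (t + ca * (s / (1 - u) - 1) + cb * (s / (1 + u) - 1)) =
        (1 - s) / s * (t - ca - cb) := by
      have h1 : s / (1 - u) = (1 + u) / s := by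
        rw [div_eq_div_iff hm.ne' hs0.ne', ← sq, hs2]
        ring
      have h2 : s / (1 + u) = (1 - u) / s := by
        rw [div_eq_div_iff hp.ne' hs0.ne', ← sq, hs2]
      have hcb' : cb = ca + u * t := by linarith
      have hs2' : s * s = (1 - u) * (1 + u) := by rw [← sq, hs2]
      rw [h1, h2, hcb']
      field_simp
      linear_combination t * hs2'
    have : 0 ≤ (1 - s) / s * (t - ca - cb) :=
      mul_nonneg (div_nonneg (by linarith) hs0.le) (by linarith)
    linarith
  -- If `a` wins in `S`, it is at least as frequent there as `b`, so the product of weights over `S`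
  -- is at least 1. Summing over all `r`-sets bounds the number of such `S` by an elementary
  -- symmetric sum.
  have hcount : (#{S ∈ F | V S = a} : ℝ) ≤ (Fintype.card ι).choose r * s ^ r := by
    calc (#{S ∈ F | V S = a} : ℝ) = ∑ S ∈ F with V S = a, 1 := by simp
      _ ≤ ∑ S ∈ F with V S = a, ∏ i ∈ S, z i := by
          refine sum_le_sum fun S hS => ?_
          obtain ⟨hS, hVS⟩ := mem_filter.1 hS
          have := hV S hS b
          rw [hVS] at this
          rw [hprod, inv_pow, ← div_eq_mul_inv, one_le_div (pow_pos hy0 _)]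
          exact pow_le_pow_right₀ hy1 this
      _ ≤ ∑ S ∈ powersetCard r univ, ∏ i ∈ S, z i :=
          sum_le_sum_of_subset_of_nonneg ((filter_subset _ _).trans hF)
            fun S _ _ => prod_nonneg fun i _ => hz0 i
      _ ≤ _ := sum_powersetCard_prod_le hz0 hrt
      _ ≤ _ := by
          have : 0 ≤ (∑ i, z i) / t := div_nonneg (sum_nonneg fun i _ => hz0 i) ht0.le
          gcongr
  have hbound := mul_sqrt_one_sub_sq_pow_le hr hu0 hu1.le
  set E := 2 / (√(Real.exp 1) * (√(4 * (r : ℝ) + 1) - 3)) with hE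
  have hE4 : 4 / (√(Real.exp 1) * (√(4 * (r : ℝ) + 1) - 3)) = 2 * E := by rw [hE]; ring
  have hE0 : 0 ≤ E := by
    have := approxRatio_sub_one_nonneg hr
    rw [hE4] at this
    linarith
  rw [hE4]
  have hspow : s ^ r = s ^ (r - 2) * ((1 - u) * (1 + u)) := by
    rw [← hs2, ← pow_add]
    congr 1
    omega
  -- The left side is `(t - c_b) + c_a`, and `c_a ≤ t - c_b`.
  have hu' : t * (1 - u) ≤ 2 * (t - cb) := by
    have : t * (1 - u) = t - (cb - ca) := by rw [← hut]; ring
    linarith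
  rw [← hut]
  calc _ ≤ (1 + 1 / (r : ℝ)) * ((Fintype.card ι).choose r * s ^ r * (u * t)) := by gcongr
    _ = (Fintype.card ι).choose r *
        ((1 + 1 / (r : ℝ)) * (u * (1 + u) * s ^ (r - 2)) * (t * (1 - u))) := by
        rw [hspow]; ring
    _ ≤ (Fintype.card ι).choose r * (E * (2 * (t - cb))) := by
        gcongr
    _ = _ := by ring

/-- Group the samples by their winner: `b` loses nothing, and each of the other `|Σ| - 1` letters
contributes at most its share. -/
theorem sum_majority_defect_le [DecidableEq ι] [Fintype α] {r : ℕ} (hr : 3 ≤ r)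
    (hrt : r ≤ Fintype.card ι) (f : ι → α) {b : α} (hb : ∀ a, #{i | f i = a} ≤ #{i | f i = b})
    {F : Finset (Finset ι)} (hF : F ⊆ powersetCard r univ)
    (V : Finset ι → α) (hV : ∀ S ∈ F, ∀ c, #{i ∈ S | f i = c} ≤ #{i ∈ S | f i = V S}) :
    (1 + 1 / (r : ℝ)) * ∑ S ∈ F, ((#{i | f i = b} : ℝ) - #{i | f i = V S}) ≤
      (Fintype.card ι).choose r * (approxRatio (Fintype.card α) r - 1) *
        (Fintype.card ι - #{i | f i = b}) := by
  have h1 : ∑ S ∈ F, ((#{i | f i = b} : ℝ) - #{i | f i = V S}) =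
      ∑ a ∈ univ.erase b, #{S ∈ F | V S = a} * ((#{i | f i = b} : ℝ) - #{i | f i = a}) := by
    rw [← sum_fiberwise F V, sum_erase _ (by simp)]
    refine sum_congr rfl fun a _ => ?_
    rw [sum_congr rfl fun S hS => by rw [(mem_filter.1 hS).2], sum_const, nsmul_eq_mul]
  have hcard : ((univ.erase b).card : ℝ) = Fintype.card α - 1 := by
    rw [card_erase_of_mem (mem_univ b), card_univ, Nat.cast_sub (Fintype.card_pos_iff.2 ⟨b⟩)]
    simp
  rw [h1, mul_sum]
  refine (sum_le_card_nsmul _ _ _ fun a ha =>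
    card_filter_majority_le hr hrt f (ne_of_mem_erase ha) (hb a) hF V hV).trans (le_of_eq ?_)
  rw [nsmul_eq_mul, hcard, approxRatio]
  ring

end Sampling

/-! ### Averaging over samples and the approximation guarantees. -/

namespace CSPInstance

variable {α : Type} {t n l : ℕ}

theorem one_le_approxRatio [Fintype α] (I : CSPInstance α t n l) {r : ℕ} (hr : 3 ≤ r) :
    1 ≤ approxRatio (Fintype.card α) r := by
  have h1 : (1 : ℝ) ≤ Fintype.card α := by
    have : 0 < Fintype.card α := Fintype.card_pos_iff.2 ⟨I.sub (⟨0, I.t_pos⟩, 0) ⟨0, I.l_pos⟩⟩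
    exact_mod_cast this
  have h2 := mul_nonneg (sub_nonneg.2 h1) (approxRatio_sub_one_nonneg hr)
  have e : approxRatio (Fintype.card α) r =
    1 + ((Fintype.card α : ℝ) - 1) * (4 / (√(Real.exp 1) * (√(4 * (r : ℝ) + 1) - 3))) := by
    rw [approxRatio]; ring
  rw [e]
  linarith

variable [DecidableEq α]

theorem columnCount_le (I : CSPInstance α t n l) (y : Sol t n l) (j : Fin l) (a : α) :
    I.columnCount y j a ≤ t :=
  (Finset.card_le_univ _).trans_eq (Fintype.card_fin t)

variable [Fintype α]

/-- Some sample other than `S₀` has a consensus with the approximation guarantee. -/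
theorem exists_sample_le (I : CSPInstance α t n l) {r : ℕ} (hr : 3 ≤ r) (hrt : r < t)
    (y : Sol t n l) (S₀ : Finset (Fin t)) (V : Finset (Fin t) → Fin l → α)
    (hV : ∀ S, S.card = r → S ≠ S₀ → ∀ j a, (S.filter fun i => I.sub (i, y i) j = a).card ≤
        (S.filter fun i => I.sub (i, y i) j = V S j).card) :
    ∃ S : Finset (Fin t), S.card = r ∧ S ≠ S₀ ∧
      ((∑ i, hammingDist (V S) (I.sub (i, y i)) : ℕ) : ℝ) ≤
        approxRatio (Fintype.card α) r * I.cost y := by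
  set F := (Finset.powersetCard r (Finset.univ : Finset (Fin t))).erase S₀ with hFdef
  have hF : F ⊆ Finset.powersetCard r Finset.univ := Finset.erase_subset _ _
  have hFmem : ∀ S ∈ F, S.card = r ∧ S ≠ S₀ := fun S hS =>
    ⟨(Finset.mem_powersetCard.1 (hF hS)).2, Finset.ne_of_mem_erase hS⟩
  have hchoose : r + 1 ≤ t.choose r := by
    simpa using Nat.choose_le_choose r (Nat.succ_le_of_lt hrt)
  have hFcard : t.choose r ≤ F.card + 1 := by
    have := Finset.pred_card_le_card_erase (s := Finset.powersetCard r (Finset.univ : Finset (Fin t)))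
      (a := S₀)
    rw [Finset.card_powersetCard, Finset.card_univ, Fintype.card_fin, ← hFdef] at this
    omega
  set b := I.consensusOf y with hb
  have hcons := I.isConsensus_consensusOf y
  set ε := approxRatio (Fintype.card α) r - 1 with hε
  have hε0 : 0 ≤ ε := sub_nonneg.2 (I.one_le_approxRatio hr)
  have hsumcast : ∀ v : Fin l → α, ((∑ i, hammingDist v (I.sub (i, y i)) : ℕ) : ℝ) =
      ∑ j, ((t : ℝ) - I.columnCount y j (v j)) := fun v => by
    rw [sum_hammingDist_eq, Nat.cast_sum]
    exact Finset.sum_congr rfl fun j _ => Nat.cast_sub (I.columnCount_le y j _)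
  have hcost : (I.cost y : ℝ) = ∑ j, ((t : ℝ) - I.columnCount y j (b j)) := hsumcast b
  have hcol : (1 + 1 / (r : ℝ)) *
      ∑ S ∈ F, ∑ j, ((I.columnCount y j (b j) : ℝ) - I.columnCount y j (V S j)) ≤
      t.choose r * ε * I.cost y := by
    rw [Finset.sum_comm, hcost, Finset.mul_sum, Finset.mul_sum]
    refine Finset.sum_le_sum fun j _ => ?_
    have := sum_majority_defect_le hr (by simpa using hrt.le) (fun i => I.sub (i, y i) j)
      (hcons j) hF (fun S => V S j) fun S hS c => hV S (hFmem S hS).1 (hFmem S hS).2 j c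
    rw [Fintype.card_fin] at this
    exact this
  have hr0 : (0 : ℝ) < r := by exact_mod_cast (by omega : 0 < r)
  -- Dropping `S₀` leaves at least `r` subsets, so the lost one is at most a fraction `1 / r` of
  -- what remains.
  have hch : (t.choose r : ℝ) ≤ (1 + 1 / (r : ℝ)) * F.card := by
    have h1 : (t.choose r : ℝ) ≤ F.card + 1 := by exact_mod_cast hFcard
    have h2 : (r : ℝ) ≤ F.card := by exact_mod_cast (by omega : r ≤ F.card)
    have h3 : 1 ≤ 1 / (r : ℝ) * F.card := by
      rw [one_div_mul_eq_div, one_le_div hr0]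
      exact h2
    linarith
  have hle : ∑ S ∈ F, ∑ j, ((I.columnCount y j (b j) : ℝ) - I.columnCount y j (V S j)) ≤
      ∑ S ∈ F, ε * I.cost y := by
    rw [Finset.sum_const, nsmul_eq_mul]
    refine le_of_mul_le_mul_left (hcol.trans ?_) (show (0 : ℝ) < 1 + 1 / r by positivity)
    rw [← mul_assoc, mul_assoc]
    exact mul_le_mul_of_nonneg_right hch (by positivity)
  have hne : F.Nonempty := Finset.card_pos.1 (by omega)
  obtain ⟨S, hS, hSle⟩ := Finset.exists_le_of_sum_le hne hle
  refine ⟨S, (hFmem S hS).1, (hFmem S hS).2, ?_⟩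
  rw [hsumcast]
  have e : ∑ j, ((t : ℝ) - I.columnCount y j (V S j)) = I.cost y +
      ∑ j, ((I.columnCount y j (b j) : ℝ) - I.columnCount y j (V S j)) := by
    rw [hcost, ← Finset.sum_add_distrib]
    exact Finset.sum_congr rfl fun j _ => by ring
  have e' : approxRatio (Fintype.card α) r * I.cost y = I.cost y + ε * I.cost y := by
    rw [hε]; ring
  rw [e, e']
  exact add_le_add_right hSle _

/-- If `bestSampled` skips none of the samples except possibly those from `S₀`, its result has the
approximation guarantee. -/
theorem exists_bestSampled_le_approxRatio (I : CSPInstance α t n l) {r : ℕ} (hr : 3 ≤ r)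
    (hrt : r < t) (skip : List (Occ t n l) → Timed Bool) (y : Sol t n l) (S₀ : Finset (Fin t))
    (hskip : ∀ S : Finset (Fin t), S.card = r → S ≠ S₀ →
      ∀ w : List (Occ t n l), (∀ i ∈ S, (i, y i) ∈ w) → (skip w).val = false) :
    ∃ z, (I.bestSampled r skip).val = ((I.cost z : ℕ∞), some z) ∧
      (I.cost z : ℝ) ≤ approxRatio (Fintype.card α) r * I.cost y := by
  have h : ∀ S : Finset (Fin t), ∃ v : Fin l → α, S.card = r → S ≠ S₀ →
      (∀ j a, (S.filter fun i => I.sub (i, y i) j = a).card ≤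
        (S.filter fun i => I.sub (i, y i) j = v j).card) ∧
      (I.bestSampled r skip).val.1 ≤ (I.cost (I.alignAll v).val : ℕ) := fun S => by
    by_cases hS : S.card = r ∧ S ≠ S₀
    · obtain ⟨v, hv⟩ := I.exists_bestSampled_le skip y S hS.1 (hskip S hS.1 hS.2)
      exact ⟨v, fun _ _ => hv⟩
    -- Arbitrary value: only subsets of size `r` other than `S₀` matter.
    · exact ⟨I.consensusOf y, fun h1 h2 => absurd ⟨h1, h2⟩ hS⟩
  choose V hV using h
  obtain ⟨S, hSr, hS₀, hle⟩ := I.exists_sample_le hr hrt y S₀ V fun S h1 h2 => (hV S h1 h2).1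
  have hm := ((hV S hSr hS₀).2).trans (Nat.cast_le.2 (I.cost_alignAll_le (V S) y))
  rcases I.bestSampled_val r skip with h | ⟨z, h⟩
  · rw [h] at hm
    simp at hm
  · refine ⟨z, h, le_trans ?_ hle⟩
    rw [h] at hm
    exact Nat.cast_le.2 (Nat.cast_le.1 hm)

theorem reoptPTAS_val (I : CSPInstance α t n l) {r : ℕ} (hrt : r ≤ t) (sol : Sol r n l) :
    (I.reoptPTAS hrt sol).val =
      if (I.cost (I.kBestAlign hrt sol).val : ℕ∞) < (I.bestSampled r (inFirst r)).val.1 then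
        (I.kBestAlign hrt sol).val
      else (I.bestSampled r (inFirst r)).val.2.getD (I.kBestAlign hrt sol).val := by
  rw [← computeCost_val]
  split_ifs with h
  · change Timed.val (ite (decide _ = true) _ _) = _
    rw [if_pos (decide_eq_true h)]
    rfl
  · change Timed.val (ite (decide _ = true) _ _) = _
    rw [if_neg (by simpa using h)]
    rfl

theorem cost_reoptPTAS_le (I : CSPInstance α t n l) {r : ℕ} (hr : 3 ≤ r) (hrt : r ≤ t)
    (opt : Sol r n l) (opt' : Sol t n l)
    (hopt : (I.firstSeqs r (by omega) hrt).IsOptimal opt) :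
    (I.cost (I.reoptPTAS hrt opt).val : ℝ) ≤
      approxRatio (Fintype.card α) r * (I.cost opt' : ℝ) := by
  rcases hrt.eq_or_lt with rfl | hlt
  -- When `t = r` the sub-instance is the whole instance, K-BEST-ALIGN returns `opt` unchanged, and
  -- its finite cost beats the `⊤` of an empty search.
  · have hskip : ∀ w : List (Occ r n l), (inFirst r w).val = true := fun w =>
      (inFirst_val r w).2 fun q _ => q.1.2
    have hA : (I.kBestAlign hrt opt).val = opt := funext fun i => I.kBestAlign_val hrt opt i.2
    rw [reoptPTAS_val, I.bestSampled_of_forall_skip r _ hskip, if_pos (ENat.natCast_lt_top _), hA]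
    have h1 : (I.cost opt : ℝ) ≤ I.cost opt' := by exact_mod_cast hopt opt'
    exact h1.trans (le_mul_of_one_le_left (Nat.cast_nonneg _) (I.one_le_approxRatio hr))
  · obtain ⟨z, hz, hle⟩ := I.exists_bestSampled_le_approxRatio hr hlt (inFirst r) opt'
      (Finset.univ.filter fun i : Fin t => (i : ℕ) < r) fun S hS hS₀ w hw => by
        rw [← Bool.not_eq_true, inFirst_val]
        intro h
        -- An `r`-set of indices below `r` is all of them, so `inFirst` rejects only the subset
        -- `S₀`.
        refine hS₀ (Finset.eq_of_subset_of_card_le (fun i hi => ?_) ?_)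
        · simpa using h _ (hw i hi)
        · rw [hS, Fin.card_filter_val_lt]
          exact min_le_right _ _
    rw [reoptPTAS_val, hz]
    split_ifs with h
    · refine le_trans ?_ hle
      exact Nat.cast_le.2 (Nat.cast_le.1 h.le)
    · exact hle

theorem exists_ptas_val (I : CSPInstance α t n l) {r : ℕ} (hr : 3 ≤ r) (hrt : r ≤ t)
    (y : Sol t n l) :
    ∃ z, (I.ptas r).val = some z ∧
      (I.cost z : ℝ) ≤ approxRatio (Fintype.card α) r * (I.cost y : ℝ) := by
  suffices h : ∃ z, (I.bestSampled r fun _ => pure false).val = ((I.cost z : ℕ∞), some z) ∧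
      (I.cost z : ℝ) ≤ approxRatio (Fintype.card α) r * I.cost y by
    obtain ⟨z, hz, hle⟩ := h
    exact ⟨z, congrArg Prod.snd hz, hle⟩
  rcases hrt.eq_or_lt with rfl | hlt
  · obtain ⟨v, hv, hle⟩ := I.exists_bestSampled_le (r := r) (fun _ => pure false) y Finset.univ
      (by simp) fun _ _ => rfl
    -- When `t = r` the sample is all of `y`, so its consensus is a consensus of `y` and aligning to
    -- it costs no more than `y`.
    have hcost := (I.cost_alignAll_le v y).trans_eq (cost_eq_of_isConsensus hv).symm
    have hm := hle.trans (Nat.cast_le.2 hcost)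
    rcases I.bestSampled_val r fun _ => pure false with h | ⟨z, h⟩
    · rw [h] at hm
      simp at hm
    · rw [h] at hm
      have h1 : (I.cost z : ℝ) ≤ I.cost y := Nat.cast_le.2 (Nat.cast_le.1 hm)
      exact ⟨z, h, h1.trans
        (le_mul_of_one_le_left (Nat.cast_nonneg _) (I.one_le_approxRatio hr))⟩
  -- The empty set is not an `r`-set, so nothing is discarded.
  · exact I.exists_bestSampled_le_approxRatio hr hlt _ y ∅ fun _ _ _ _ _ => rfl

end CSPInstance

theorem tendsto_approxRatio (s : ℕ) :
    Filter.Tendsto (approxRatio s) Filter.atTop (nhds 1) := by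
  have h1 : Filter.Tendsto (fun r : ℕ => √(4 * (r : ℝ) + 1) - 3) Filter.atTop Filter.atTop :=
    Filter.tendsto_atTop_add_const_right _ _ (Real.tendsto_sqrt_atTop.comp
      (Filter.tendsto_atTop_add_const_right _ _
        (tendsto_natCast_atTop_atTop.const_mul_atTop (by norm_num))))
  have h2 := (h1.const_mul_atTop (Real.sqrt_pos.2 (Real.exp_pos 1))).const_div_atTop
    (4 * (s : ℝ) - 4)
  have h3 := h2.const_add 1
  rw [add_zero] at h3
  exact h3

theorem mainTheorem2 :
    -- approximation guarantee of the reoptimization algorithm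
    (∀ (r : ℕ) (hr : 3 ≤ r) (α : Type) [Fintype α] [DecidableEq α] (t n l : ℕ) (hrt : r ≤ t)
      (I : CSPInstance α t n l) (opt : Sol r n l) (opt' : Sol t n l),
      (I.firstSeqs r (by omega) hrt).IsOptimal opt → I.IsOptimal opt' →
        (I.cost (I.reoptPTAS hrt opt).val : ℝ) ≤
          approxRatio (Fintype.card α) r * (I.cost opt' : ℝ)) ∧
    -- running time of the reoptimization algorithm
    (∀ (r : ℕ) (hr : 1 ≤ r), ∃ C : ℕ,
      ∀ (α : Type) [Fintype α] [DecidableEq α] (t n l : ℕ) (hrt : r < t)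
        (I : CSPInstance α t n l) (opt : Sol r n l),
        (I.firstSeqs r (by omega) hrt.le).IsOptimal opt →
          (I.reoptPTAS hrt.le opt).steps ≤ C * (l * t * n * ((t - r) * n) ^ r)) ∧
    -- the algorithm that tries all the samples: same guarantee, and its running time
    (∀ (r : ℕ), 3 ≤ r → ∀ (α : Type) [Fintype α] [DecidableEq α] (t n l : ℕ), r ≤ t →
      ∀ (I : CSPInstance α t n l) (opt' : Sol t n l), I.IsOptimal opt' →
        ∃ y, (I.ptas r).val = some y ∧
          (I.cost y : ℝ) ≤ approxRatio (Fintype.card α) r * (I.cost opt' : ℝ)) ∧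
    (∀ (r : ℕ), 1 ≤ r → ∃ C : ℕ,
      ∀ (α : Type) [DecidableEq α] (t n l : ℕ), r ≤ t →
        ∀ I : CSPInstance α t n l, (I.ptas r).steps ≤ C * (l * (t * n) ^ (r + 1))) ∧
    -- approximation scheme: the ratio tends to one as the sampling size grows
    (∀ s : ℕ, Filter.Tendsto (approxRatio s) Filter.atTop (nhds 1)) := by
  refine ⟨?_, ?_, ?_, ?_, tendsto_approxRatio⟩
  · intro r hr α _ _ t n l hrt I opt opt' hopt _
    exact I.cost_reoptPTAS_le hr hrt opt opt' hopt
  · intro r _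
    exact ⟨_, fun α _ _ t n l hrt I opt _ => I.reoptPTAS_steps_le hrt opt⟩
  · intro r hr α _ _ t n l hrt I opt' _
    exact I.exists_ptas_val hr hrt opt'
  · intro r _
    exact ⟨_, fun α _ t n l _ I => I.ptas_steps_le r⟩
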